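/- Let $n \ge 2$, let $\lambda_1 > \lambda_2 > \dots > \lambda_n$ be real numbers, and let $A$ be a random $n \times n$ Hermitian matrix drawn uniformly among all Hermitian matrices with eigenvalues $\lambda_1,\dots,\lambda_n$, i.e. $A$ has the law of $U\,\mathrm{diag}(\lambda_1,\dots,\lambda_n)\,U^*$ with $U$ distributed according to Haar probability measure on the unitary group $U(n)$. Let $x_1 \ge \dots \ge x_{n-1}$ be the eigenvalues of the top left $(n-1)\times(n-1)$ minor of $A$. For $1 \le j \le n$ let $$ Q_j(x) = \sum_{i \le j} \frac{\prod_{\ell \ne i}(x-\lambda_\ell)}{\prod_{\ell \neq i}(\lambda_i-\lambda_\ell)}, $$ and for $1 \le i \le n-1$ let $I_i = [\lambda_{i+1},\lambda_i]$. Then $Q_j$ is the unique polynomial of degree at most $n-1$ with $Q_j(\lambda_i) = 1$ for $i \le j$ and $Q_j(\lambda_i)=0$ for $i > j$ $(1 \le i \le n)$, and it has degree exactly $n-1$ if $j<n$. Moreover the random variables $\lambda_i - x_i$ are square integrable, $$ \mathbb{E}(\lambda_i - x_i) = \int_{I_i} Q_i(x)\,dx \qquad \text{for all } 1 \le i \le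 n-1, $$ and $$ \operatorname{cov}(\lambda_i - x_i, \lambda_j - x_j) = \left(\int_{I_i} (1-Q_j(x))\,dx\right)\left(\int_{I_j} Q_i(x)\,dx\right) \qquad \text{for all } 1 \le i < j \le n-1. $$ -/

import Mathlib

open MeasureTheory ProbabilityTheory Polynomial

/-- The (Borel) product σ-algebra on matrices. -/
instance Matrix.entrywiseMeasurableSpace {m n α : Type*} [MeasurableSpace α] :
    MeasurableSpace (Matrix m n α) :=
  inferInstanceAs (MeasurableSpace (m → n → α))

instance Matrix.entrywiseBorelSpace {m n : Type*} [Countable m] [Countable n] :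
    BorelSpace (Matrix m n ℂ) :=
  inferInstanceAs (BorelSpace (m → n → ℂ))

instance Matrix.unitaryGroup_compactSpace (n : ℕ) :
    CompactSpace (Matrix.unitaryGroup (Fin n) ℂ) := by
  suffices h : IsCompact (Matrix.unitaryGroup (Fin n) ℂ : Set (Matrix (Fin n) (Fin n) ℂ)) from
    isCompact_iff_compactSpace.mp h
  have hK : IsCompact (Set.univ.pi fun _ : Fin n => Set.univ.pi fun _ : Fin n =>
      Metric.closedBall (0 : ℂ) 1) :=
    isCompact_univ_pi fun _ => isCompact_univ_pi fun _ => isCompact_closedBall 0 1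
  have hcl : IsClosed
      ((Matrix.unitaryGroup (Fin n) ℂ : Set (Matrix (Fin n) (Fin n) ℂ))) := by
    have h : (Matrix.unitaryGroup (Fin n) ℂ : Set (Matrix (Fin n) (Fin n) ℂ))
        = {U | U * star U = 1} := by
      ext U
      exact Matrix.mem_unitaryGroup_iff
    rw [h]
    exact isClosed_eq (by fun_prop) continuous_const
  refine IsCompact.of_isClosed_subset hK hcl ?_
  intro U hU i _ j _
  simpa using entry_norm_bound_of_unitary hU i j

/-- The Haar probability measure on the compact group `U(n)`. -/
noncomputable def haarUnitary (n : ℕ) : Measure (Matrix.unitaryGroup (Fin n) ℂ) :=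
  Measure.haarMeasure ⊤

/-- The law of a uniformly random Hermitian matrix with eigenvalues `l`: the law of
`U diag(l) U*` with `U` Haar distributed on `U(n)`, i.e. the unitarily invariant probability
measure on the set of Hermitian matrices with eigenvalues `l`. -/
noncomputable def uniformHermitian {n : ℕ} (l : Fin n → ℝ) :
    Measure (Matrix (Fin n) (Fin n) ℂ) :=
  (haarUnitary n).map fun U : Matrix.unitaryGroup (Fin n) ℂ =>
    (U : Matrix (Fin n) (Fin n) ℂ) * Matrix.diagonal (fun i => (l i : ℂ)) *
      star (U : Matrix (Fin n) (Fin n) ℂ)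

/-- The eigenvalues `x₀ ≥ x₁ ≥ … ≥ x_{m-1}`, with multiplicity and in decreasing order, of the
top left `m × m` minor of a Hermitian `(m+1) × (m+1)` matrix. -/
noncomputable def minorEigenvalue {m : ℕ} {A : Matrix (Fin (m + 1)) (Fin (m + 1)) ℂ}
    (hA : A.IsHermitian) (i : Fin m) : ℝ :=
  (hA.submatrix (Fin.castSucc : Fin m → Fin (m + 1))).eigenvalues₀
    (Fin.cast (Fintype.card_fin m).symm i)

/-- The interval `[l_{i+1}, l_i]`. -/
def gapInterval {m : ℕ} (l : Fin (m + 1) → ℝ) (i : Fin m) : Set ℝ :=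
  Set.Icc (l i.succ) (l i.castSucc)

/-- The polynomial `∑_{i ≤ j} ∏_{k ≠ i} (X - l_k) / ∏_{k ≠ i} (l_i - l_k)`. -/
noncomputable def stepPoly {n : ℕ} (l : Fin n → ℝ) (j : Fin n) : ℝ[X] :=
  ∑ i ∈ Finset.univ.filter (fun i => i ≤ j),
    C ((∏ k ∈ Finset.univ.erase i, (l i - l k))⁻¹) * ∏ k ∈ Finset.univ.erase i, (X - C (l k))

/-! Write `Q_j` for `stepPoly l j` and `p` for the characteristic polynomial of the minor. Since `p`
is a diagonal cofactor of `X - A`, conjugating by `U` gives `p = ∑ w_k ∏_{i ≠ k} (X - l_i)`, where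
`w_k` is the squared modulus of the `k`-th entry in the last row of `U`
(`minorWeight_unitary_conj`). A Haar row has the direction of a uniform point of the unit ball of
`ℂⁿ` (`setLIntegral_complexBall_eq`), and the squared moduli of such a point are uniform on the
corner `{e > 0, ∑ e < 1}` (`setLIntegral_normSq`).

Positive weights correspond bijectively to a scale `s > 0` and one root in each open gap of `l`. The
Jacobian of this correspondence is a constant times `s ^ m` times the Vandermonde determinant of the
roots (`abs_det_weightJacobian`). Hence the eigenvalues of the minor have density proportional to
the Vandermonde determinant on the product of the gaps (`exists_map_minorEigenvalue_eq`).

The `m` derivatives `Q_j'` have degree below `m`, so the Vandermonde determinant is proportional to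
`det (Q_j'(x_i))`. On the other hand `∫_{I_i} Q_j' = Q_j(l_i) - Q_j(l_{i+1}) = δ_ij`. The
expectation of a product of one-variable functions is therefore the determinant of a matrix equal to
the identity outside the columns of the variables involved. One variable leaves a single integral,
two leave a `2 × 2` determinant. Integration by parts turns the entries into integrals of `Q_j` or
`1 - Q_j`, and the off-diagonal product is the covariance. -/

/-! ### Interpolation and degree of the step polynomials. -/

section StepPoly

variable {m : ℕ} {l : Fin (m + 1) → ℝ}

lemma stepPoly_eq_sum_basis (l : Fin (m + 1) → ℝ) (j : Fin (m + 1)) :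
    stepPoly l j =
      ∑ i ∈ Finset.univ.filter (fun i => i ≤ j), Lagrange.basis Finset.univ l i := by
  refine Finset.sum_congr rfl fun i _ => ?_
  simp_rw [Lagrange.basis, Lagrange.basisDivisor, Finset.prod_mul_distrib, ← map_prod,
    Finset.prod_inv_distrib]

lemma stepPoly_eval_node (hl : StrictAnti l) (j i : Fin (m + 1)) :
    (stepPoly l j).eval (l i) = if i ≤ j then 1 else 0 := by
  rw [stepPoly_eq_sum_basis, eval_finsetSum]
  have h : ∀ k, (Lagrange.basis Finset.univ l k).eval (l i) = if k = i then 1 else 0 := by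
    intro k
    split_ifs with hk
    · rw [hk, Lagrange.eval_basis_self hl.injective.injOn (Finset.mem_univ i)]
    · rw [Lagrange.eval_basis_of_ne hk (Finset.mem_univ i)]
  simp [h, Finset.sum_ite_eq']

lemma stepPoly_natDegree_le (hl : StrictAnti l) (j : Fin (m + 1)) :
    (stepPoly l j).natDegree ≤ m := by
  rw [stepPoly_eq_sum_basis]
  refine natDegree_sum_le_of_forall_le _ _ fun i _ => ?_
  rw [Lagrange.natDegree_basis hl.injective.injOn (Finset.mem_univ i)]
  simp

lemma eq_of_eval_nodes_eq {l : Fin (m + 1) → ℝ} (hl : Function.Injective l) {p q : ℝ[X]}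
    (hp : p.natDegree ≤ m) (hq : q.natDegree ≤ m) (h : ∀ i, p.eval (l i) = q.eval (l i)) :
    p = q := by
  refine Polynomial.eq_of_degrees_lt_of_eval_index_eq (v := l) Finset.univ hl.injOn ?_ ?_
    fun i _ => h i
  · exact lt_of_le_of_lt (degree_le_of_natDegree_le hp) (by simp; exact_mod_cast Nat.lt_succ_self m)
  · exact lt_of_le_of_lt (degree_le_of_natDegree_le hq) (by simp; exact_mod_cast Nat.lt_succ_self m)

lemma eq_stepPoly_iff (hl : StrictAnti l) (j : Fin (m + 1)) (q : ℝ[X]) :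
    (q.natDegree ≤ m ∧ ∀ i, q.eval (l i) = if i ≤ j then 1 else 0) ↔ q = stepPoly l j := by
  constructor
  · rintro ⟨h1, h2⟩
    exact eq_of_eval_nodes_eq hl.injective h1 (stepPoly_natDegree_le hl j)
      fun i => by rw [h2, stepPoly_eval_node hl]
  · rintro rfl
    exact ⟨stepPoly_natDegree_le hl j, stepPoly_eval_node hl j⟩

lemma gap_lt (hl : StrictAnti l) (i : Fin m) : l i.succ < l i.castSucc :=
  hl Fin.castSucc_lt_succ

/-- Points of distinct open gaps of a strictly decreasing sequence are strictly decreasing. -/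
lemma strictAnti_of_mem_gaps (hl : StrictAnti l) {x : Fin m → ℝ}
    (hx : ∀ i, x i ∈ Set.Ioo (l i.succ) (l i.castSucc)) : StrictAnti x := by
  intro i j hij
  calc x j < l j.castSucc := (hx j).2
    _ ≤ l i.succ := hl.antitone (by rw [Fin.le_def]; simpa using hij)
    _ < x i := (hx i).1

/-- By Rolle, the derivative vanishes inside every gap but the `j`-th, which gives `m - 1` distinct
zeros. It is not the zero polynomial, because the step polynomial takes both values 0 and 1. -/
lemma stepPoly_natDegree (hl : StrictAnti l) (j : Fin m) :
    (stepPoly l j.castSucc).natDegree = m := by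
  set Q := stepPoly l j.castSucc with hQ
  refine le_antisymm (stepPoly_natDegree_le hl _) ?_
  have hdeg : 1 ≤ Q.natDegree := by
    by_contra h
    obtain ⟨c, hc⟩ := natDegree_eq_zero.mp (by omega : Q.natDegree = 0)
    have h1 := stepPoly_eval_node hl j.castSucc j.castSucc
    have h2 := stepPoly_eval_node hl j.castSucc j.succ
    rw [← hQ, ← hc] at h1 h2
    simp [Fin.castSucc_lt_succ.not_ge] at h1 h2
    linarith
  have hder : derivative Q ≠ 0 := fun h => by
    have := derivative_eq_zero.mp h
    omega
  have hrolle : ∀ i : Fin m, ∃ c ∈ Set.Ioo (l i.succ) (l i.castSucc),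
      i ≠ j → (derivative Q).eval c = 0 := by
    intro i
    by_cases hij : i = j
    -- An arbitrary filler point, so that `c` is defined on all gaps and injective.
    · obtain ⟨c, hc⟩ := exists_between (gap_lt hl i)
      exact ⟨c, hc, fun h => absurd hij h⟩
    · have hend : Q.eval (l i.succ) = Q.eval (l i.castSucc) := by
        rw [hQ, stepPoly_eval_node hl, stepPoly_eval_node hl]
        have : i.succ ≤ j.castSucc ↔ i.castSucc ≤ j.castSucc := by
          simp only [Fin.le_def, Fin.val_succ, Fin.val_castSucc]
          have := Fin.val_ne_of_ne hij
          omega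
        simp only [this]
      obtain ⟨c, hc, hc'⟩ := exists_deriv_eq_zero (gap_lt hl i) Q.continuous.continuousOn hend
      exact ⟨c, hc, fun _ => by rwa [Polynomial.deriv] at hc'⟩
  choose c hc hc0 using hrolle
  have hinj : Function.Injective c := (strictAnti_of_mem_gaps hl hc).injective
  have hcard := Polynomial.card_le_degree_of_subset_roots (p := derivative Q)
    (Z := (Finset.univ.erase j).image c) (by
      intro x hx
      obtain ⟨i, hi, rfl⟩ := Finset.mem_image.mp (Finset.mem_val.mp hx)
      exact (mem_roots hder).mpr (hc0 i (Finset.ne_of_mem_erase hi)))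
  rw [Finset.card_image_of_injective _ hinj, Finset.card_erase_of_mem (Finset.mem_univ j)] at hcard
  have := natDegree_derivative_le Q
  simp at hcard
  omega

end StepPoly

/-! ### Integrals over the gaps. -/

section GapIntegrals

variable {m : ℕ} {l : Fin (m + 1) → ℝ}

lemma setIntegral_openGap (hl : StrictAnti l) (i : Fin m) (f : ℝ → ℝ) :
    ∫ x in Set.Ioo (l i.succ) (l i.castSucc), f x = ∫ x in l i.succ..l i.castSucc, f x := by
  rw [intervalIntegral.integral_of_le (gap_lt hl i).le, integral_Ioc_eq_integral_Ioo]

lemma setIntegral_gapInterval (hl : StrictAnti l) (i : Fin m) (f : ℝ → ℝ) :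
    ∫ x in gapInterval l i, f x = ∫ x in l i.succ..l i.castSucc, f x := by
  rw [intervalIntegral.integral_of_le (gap_lt hl i).le, gapInterval, integral_Icc_eq_integral_Ioc]

lemma intervalIntegral_derivative (p : ℝ[X]) (a b : ℝ) :
    ∫ x in a..b, (derivative p).eval x = p.eval b - p.eval a := by
  refine intervalIntegral.integral_eq_sub_of_hasDerivAt (fun x _ => p.hasDerivAt x) ?_
  exact (derivative p).continuous.intervalIntegrable _ _

/-- Integration by parts against `b - x`. -/
lemma intervalIntegral_sub_mul_derivative (p : ℝ[X]) (a b : ℝ) :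
    ∫ x in a..b, (b - x) * (derivative p).eval x =
      (∫ x in a..b, p.eval x) - (b - a) * p.eval a := by
  have h := intervalIntegral_derivative ((C b - X) * p) a b
  simp only [derivative_mul, derivative_sub, derivative_C, derivative_X, eval_add, eval_mul,
    eval_sub, eval_C, eval_X, zero_sub, eval_neg, eval_one, sub_self, zero_mul] at h
  rw [intervalIntegral.integral_add (Continuous.intervalIntegrable (by fun_prop) _ _)
    (Continuous.intervalIntegrable (by fun_prop) _ _)] at h
  simp only [neg_mul, one_mul, intervalIntegral.integral_neg] at h
  linarith

/-- Among the gaps, only across the `j`-th do the two endpoint values differ, and there they are 0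
and 1. This duality makes the determinants of moments almost trivial. -/
lemma integral_openGap_derivative_stepPoly (hl : StrictAnti l) (i j : Fin m) :
    ∫ x in Set.Ioo (l i.succ) (l i.castSucc), (derivative (stepPoly l j.castSucc)).eval x =
      (1 : Matrix (Fin m) (Fin m) ℝ) i j := by
  rw [setIntegral_openGap hl, intervalIntegral_derivative, stepPoly_eval_node hl,
    stepPoly_eval_node hl, Matrix.one_apply]
  simp only [Fin.le_def, Fin.val_succ, Fin.val_castSucc, Fin.ext_iff]
  split_ifs <;> first | omega | norm_num

/-- For `j ≤ i` the polynomial `stepPoly l j` vanishes at the left end of the `i`-th gap. -/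
lemma integral_openGap_of_le (hl : StrictAnti l) {i j : Fin m} (hij : j ≤ i) :
    ∫ x in Set.Ioo (l i.succ) (l i.castSucc),
        (l i.castSucc - x) * (derivative (stepPoly l j.castSucc)).eval x =
      ∫ x in gapInterval l i, (stepPoly l j.castSucc).eval x := by
  rw [setIntegral_openGap hl, setIntegral_gapInterval hl, intervalIntegral_sub_mul_derivative,
    stepPoly_eval_node hl, if_neg, mul_zero, sub_zero]
  simp only [Fin.le_def, Fin.val_succ, Fin.val_castSucc] at hij ⊢
  omega

/-- For `i < j` the polynomial `stepPoly l j` equals one at the left end of the `i`-th gap. -/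
lemma integral_openGap_of_lt (hl : StrictAnti l) {i j : Fin m} (hij : i < j) :
    ∫ x in Set.Ioo (l i.succ) (l i.castSucc),
        (l i.castSucc - x) * (derivative (stepPoly l j.castSucc)).eval x =
      -∫ x in gapInterval l i, (1 - (stepPoly l j.castSucc).eval x) := by
  rw [setIntegral_openGap hl, setIntegral_gapInterval hl, intervalIntegral_sub_mul_derivative,
    stepPoly_eval_node hl, if_pos, intervalIntegral.integral_sub (by simp)
      (Continuous.intervalIntegrable (by fun_prop) _ _)]
  · simp
  · simp only [Fin.le_def, Fin.val_succ, Fin.val_castSucc, Fin.lt_def] at hij ⊢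
    omega

end GapIntegrals

/-! ### Positive weights correspond to a scale and interlacing roots. -/

/-- The product `∏_{k ≠ i} (l_i - l_k)`. -/
noncomputable def nodeDen {n : ℕ} (l : Fin n → ℝ) (i : Fin n) : ℝ :=
  ∏ k ∈ Finset.univ.erase i, (l i - l k)

/-- The coefficients of `y₀ ∏ (X - y_{i+1})` in the basis `∏_{k ≠ i} (X - l_k)`. -/
noncomputable def weightMap {m : ℕ} (l y : Fin (m + 1) → ℝ) (k : Fin (m + 1)) : ℝ :=
  y 0 * (Lagrange.nodal Finset.univ (Fin.tail y)).eval (l k) / nodeDen l k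

/-- The product of the open gaps of `l`. -/
def gapBox {m : ℕ} (l : Fin (m + 1) → ℝ) : Set (Fin m → ℝ) :=
  Set.univ.pi fun i => Set.Ioo (l i.succ) (l i.castSucc)

section WeightMap

variable {m : ℕ} {l : Fin (m + 1) → ℝ}

lemma mem_gapBox {x : Fin m → ℝ} :
    x ∈ gapBox l ↔ ∀ i, x i ∈ Set.Ioo (l i.succ) (l i.castSucc) := by
  simp [gapBox]

lemma nodeDen_ne_zero {n : ℕ} {l : Fin n → ℝ} (hl : Function.Injective l) (k : Fin n) :
    nodeDen l k ≠ 0 :=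
  Finset.prod_ne_zero_iff.mpr fun _ hj =>
    sub_ne_zero.mpr (hl.ne (Finset.ne_of_mem_erase hj).symm)

lemma prod_erase_eq_prod_succAbove {M : Type*} [CommMonoid M] (k : Fin (m + 1))
    (f : Fin (m + 1) → M) :
    ∏ j ∈ Finset.univ.erase k, f j = ∏ i : Fin m, f (k.succAbove i) := by
  have h : Finset.univ.erase k = Finset.univ.map k.succAboveEmb := by
    ext j
    simp [← Fin.exists_succAbove_eq_iff]
  rw [h, Finset.prod_map]
  rfl

/-- `succAbove` pairs `x i` with the end of its gap farther from `l k`. Both lie on the same side of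
`l k`, so each quotient of factors is positive. -/
lemma nodal_div_nodeDen_pos (hl : StrictAnti l) {x : Fin m → ℝ} (hx : x ∈ gapBox l)
    (k : Fin (m + 1)) :
    0 < (Lagrange.nodal Finset.univ x).eval (l k) / nodeDen l k := by
  rw [mem_gapBox] at hx
  rw [Lagrange.eval_nodal, nodeDen, prod_erase_eq_prod_succAbove, ← Finset.prod_div_distrib]
  refine Finset.prod_pos fun i _ => ?_
  rcases lt_or_ge i.castSucc k with h | h
  · rw [Fin.succAbove_of_castSucc_lt _ _ h]
    refine div_pos_of_neg_of_neg ?_ (sub_neg.mpr (hl h))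
    have : l k ≤ l i.succ := hl.antitone (Fin.castSucc_lt_iff_succ_le.mp h)
    linarith [(hx i).1]
  · rw [Fin.succAbove_of_le_castSucc _ _ h]
    refine div_pos ?_ (sub_pos.mpr (hl (h.trans_lt Fin.castSucc_lt_succ)))
    have : l i.castSucc ≤ l k := hl.antitone h
    linarith [(hx i).2]

lemma gapBox_nonempty (hl : StrictAnti l) : (gapBox l).Nonempty :=
  Set.univ_pi_nonempty_iff.mpr fun i => Set.nonempty_Ioo.mpr (gap_lt hl i)

/-- At the nodes `nodeDen` has the sign of any monic polynomial with one root per gap, and such a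
polynomial changes sign across each gap. -/
lemma nodeDen_mul_nodeDen_neg (hl : StrictAnti l) (i : Fin m) :
    nodeDen l i.succ * nodeDen l i.castSucc < 0 := by
  obtain ⟨x, hx⟩ := gapBox_nonempty hl
  have h1 := nodal_div_nodeDen_pos hl hx i.succ
  have h2 := nodal_div_nodeDen_pos hl hx i.castSucc
  rw [mem_gapBox] at hx
  have h3 : (Lagrange.nodal Finset.univ x).eval (l i.succ) *
      (Lagrange.nodal Finset.univ x).eval (l i.castSucc) < 0 := by
    rw [Lagrange.eval_nodal, Lagrange.eval_nodal, ← Finset.prod_mul_distrib,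
      ← Finset.mul_prod_erase _ _ (Finset.mem_univ i)]
    refine mul_neg_of_neg_of_pos (mul_neg_of_neg_of_pos ?_ ?_) (Finset.prod_pos fun j hj => ?_)
    · linarith [(hx i).1]
    · linarith [(hx i).2]
    · rcases lt_or_gt_of_ne (Finset.ne_of_mem_erase hj) with h | h
      · have e1 : l i.castSucc ≤ l j.succ := hl.antitone (by rw [Fin.le_def]; simpa using h)
        have e2 := gap_lt hl i
        have := (hx j).1
        exact mul_pos_of_neg_of_neg (by linarith) (by linarith)
      · have e1 : l j.castSucc ≤ l i.succ := hl.antitone (by rw [Fin.le_def]; simpa using h)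
        have e2 := gap_lt hl i
        have := (hx j).2
        exact mul_pos (by linarith) (by linarith)
  rcases div_pos_iff.mp h1 with ⟨a, b⟩ | ⟨a, b⟩ <;> rcases div_pos_iff.mp h2 with ⟨c, d⟩ | ⟨c, d⟩
  · exact absurd h3 (mul_pos a c).not_gt
  · exact mul_neg_of_pos_of_neg b d
  · exact mul_neg_of_neg_of_pos b d
  · exact absurd h3 (mul_pos_of_neg_of_neg a c).not_gt

/-- The unnormalised eigenvalue coordinates: a positive scale, and one point per gap. -/
def gapCone (l : Fin (m + 1) → ℝ) : Set (Fin (m + 1) → ℝ) :=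
  {y | 0 < y 0 ∧ Fin.tail y ∈ gapBox l}

lemma weightMap_pos (hl : StrictAnti l) {y : Fin (m + 1) → ℝ} (hy : y ∈ gapCone l)
    (k : Fin (m + 1)) : 0 < weightMap l y k := by
  rw [weightMap, mul_div_assoc]
  exact mul_pos hy.1 (nodal_div_nodeDen_pos hl hy.2 k)

lemma sum_eval_div_nodeDen {l : Fin (m + 1) → ℝ} (hl : Function.Injective l) {p : ℝ[X]}
    (hp : p.natDegree ≤ m) : ∑ k, p.eval (l k) / nodeDen l k = p.coeff m := by
  have h := Lagrange.coeff_eq_sum (s := Finset.univ) (v := l) hl.injOn (P := p)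
    (lt_of_le_of_lt (degree_le_of_natDegree_le hp)
      (by simp; exact_mod_cast Nat.lt_succ_self m))
  simp only [Finset.card_univ, Fintype.card_fin, Nat.add_sub_cancel] at h
  exact h.symm

lemma natDegree_C_mul_nodal_le (s : ℝ) (x : Fin m → ℝ) :
    (C s * Lagrange.nodal Finset.univ x).natDegree ≤ m :=
  (natDegree_C_mul_le _ _).trans (by simp [Lagrange.natDegree_nodal])

lemma coeff_nodal (x : Fin m → ℝ) : (Lagrange.nodal Finset.univ x).coeff m = 1 := by
  have h := Lagrange.nodal_monic (s := Finset.univ) (v := x)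
  rw [Monic, leadingCoeff, Lagrange.natDegree_nodal] at h
  simpa using h

/-- The sum of the weights is the leading coefficient of the interpolated polynomial. -/
lemma sum_weightMap (hl : StrictAnti l) (y : Fin (m + 1) → ℝ) :
    ∑ k, weightMap l y k = y 0 := by
  have h := sum_eval_div_nodeDen hl.injective (natDegree_C_mul_nodal_le (y 0) (Fin.tail y))
  simp only [eval_mul, eval_C, coeff_C_mul, coeff_nodal, mul_one] at h
  exact h

lemma nodal_injOn_gapBox (hl : StrictAnti l) {x x' : Fin m → ℝ} (hx : x ∈ gapBox l)
    (hx' : x' ∈ gapBox l) (h : Lagrange.nodal Finset.univ x = Lagrange.nodal Finset.univ x') :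
    x = x' := by
  rw [mem_gapBox] at hx hx'
  funext i
  have h0 := Lagrange.eval_nodal_at_node (v := x) (Finset.mem_univ i)
  rw [h, Lagrange.eval_nodal, Finset.prod_eq_zero_iff] at h0
  obtain ⟨j, -, hj⟩ := h0
  rw [sub_eq_zero] at hj
  rcases lt_trichotomy i j with hij | rfl | hij
  · have : l j.castSucc ≤ l i.succ := hl.antitone (by rw [Fin.le_def]; simpa using hij)
    linarith [(hx i).1, (hx' j).2]
  · exact hj
  · have : l i.castSucc ≤ l j.succ := hl.antitone (by rw [Fin.le_def]; simpa using hij)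
    linarith [(hx i).2, (hx' j).1]

lemma weightMap_injOn (hl : StrictAnti l) : Set.InjOn (weightMap l) (gapCone l) := by
  intro y hy y' hy' h
  have h0 : y 0 = y' 0 := by rw [← sum_weightMap hl y, ← sum_weightMap hl y', h]
  have h1 : C (y 0) * Lagrange.nodal Finset.univ (Fin.tail y) =
      C (y' 0) * Lagrange.nodal Finset.univ (Fin.tail y') := by
    refine eq_of_eval_nodes_eq hl.injective (natDegree_C_mul_nodal_le _ _)
      (natDegree_C_mul_nodal_le _ _) fun i => ?_
    have := congrFun h i
    simp only [weightMap] at this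
    rw [div_left_inj' (nodeDen_ne_zero hl.injective i)] at this
    simpa using this
  rw [h0] at h1
  have h2 := mul_left_cancel₀ (C_ne_zero.mpr hy'.1.ne') h1
  have h3 := nodal_injOn_gapBox hl hy.2 hy'.2 h2
  rw [← Fin.cons_self_tail y, ← Fin.cons_self_tail y', h0, h3]

lemma exists_root_of_mul_neg (q : ℝ[X]) {a b : ℝ} (hab : a < b) (h : q.eval a * q.eval b < 0) :
    ∃ c ∈ Set.Ioo a b, q.eval c = 0 := by
  rcases mul_neg_iff.mp h with ⟨h1, h2⟩ | ⟨h1, h2⟩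
  · exact intermediate_value_Ioo' hab.le q.continuous.continuousOn ⟨h2, h1⟩
  · exact intermediate_value_Ioo hab.le q.continuous.continuousOn ⟨h1, h2⟩

/-- The polynomial of degree at most `m` with values `e k * nodeDen l k` at the nodes alternates in
sign, hence has a root in each gap, and these are all its roots. -/
lemma exists_weightMap_eq (hl : StrictAnti l) {e : Fin (m + 1) → ℝ} (he : ∀ k, 0 < e k) :
    ∃ y ∈ gapCone l, weightMap l y = e := by
  set q := Lagrange.interpolate Finset.univ l (fun k => e k * nodeDen l k) with hq
  have hqe : ∀ k, q.eval (l k) = e k * nodeDen l k := fun k =>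
    Lagrange.eval_interpolate_at_node _ hl.injective.injOn (Finset.mem_univ k)
  have hqd : q.natDegree ≤ m := by
    have h := Lagrange.degree_interpolate_le (s := Finset.univ) (v := l)
      (fun k => e k * nodeDen l k) hl.injective.injOn
    simp only [Finset.card_univ, Fintype.card_fin, Nat.add_sub_cancel] at h
    exact natDegree_le_of_degree_le h
  have hroot : ∀ i : Fin m, ∃ c ∈ Set.Ioo (l i.succ) (l i.castSucc), q.eval c = 0 := by
    intro i
    refine exists_root_of_mul_neg q (gap_lt hl i) ?_
    rw [hqe, hqe, mul_mul_mul_comm]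
    exact mul_neg_of_pos_of_neg (mul_pos (he _) (he _)) (nodeDen_mul_nodeDen_neg hl i)
  choose x hx hx0 using hroot
  have hs : q.coeff m = ∑ k, e k := by
    rw [← sum_eval_div_nodeDen hl.injective hqd]
    refine Finset.sum_congr rfl fun k _ => ?_
    rw [hqe, mul_div_cancel_right₀ _ (nodeDen_ne_zero hl.injective k)]
  -- The top coefficients cancel, so the difference has degree below `m` and vanishes at the `m`
  -- distinct points `x i`.
  have hqx : q = C (q.coeff m) * Lagrange.nodal Finset.univ x := by
    refine Polynomial.eq_of_degree_sub_lt_of_eval_index_eq (v := x) Finset.univ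
      (strictAnti_of_mem_gaps hl hx).injective.injOn ?_ fun i _ => ?_
    · rw [Finset.card_univ, Fintype.card_fin, degree_lt_iff_coeff_zero]
      intro k hk
      rcases hk.eq_or_lt with rfl | hk
      · simp [coeff_nodal]
      · rw [coeff_sub, coeff_eq_zero_of_natDegree_lt (hqd.trans_lt hk),
          coeff_eq_zero_of_natDegree_lt ((natDegree_C_mul_nodal_le _ _).trans_lt hk), sub_zero]
    · rw [hx0, eval_mul, Lagrange.eval_nodal_at_node (Finset.mem_univ i), mul_zero]
  refine ⟨Fin.cons (q.coeff m) x, ⟨?_, ?_⟩, ?_⟩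
  · rw [Fin.cons_zero, hs]
    exact Finset.sum_pos (fun k _ => he k) Finset.univ_nonempty
  · rw [Fin.tail_cons, mem_gapBox]
    exact hx
  · funext k
    have h := congrArg (eval (l k)) hqx
    rw [hqe, eval_mul, eval_C] at h
    rw [weightMap, Fin.cons_zero, Fin.tail_cons, ← h,
      mul_div_cancel_right₀ _ (nodeDen_ne_zero hl.injective k)]

lemma image_weightMap (hl : StrictAnti l) :
    weightMap l '' (gapCone l ∩ {y | y 0 < 1}) = {e | (∀ k, 0 < e k) ∧ ∑ k, e k < 1} := by
  ext e
  constructor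
  · rintro ⟨y, ⟨hy, hy1⟩, rfl⟩
    exact ⟨weightMap_pos hl hy, by rwa [sum_weightMap hl]⟩
  · rintro ⟨he, he1⟩
    obtain ⟨y, hy, rfl⟩ := exists_weightMap_eq hl he
    exact ⟨y, ⟨hy, by rwa [sum_weightMap hl] at he1⟩, rfl⟩

end WeightMap

/-! ### The Jacobian determinant of the weights. -/

section Jacobian

variable {m : ℕ} {l : Fin (m + 1) → ℝ}

/-- The factors of `y₀ ∏ (X - y_{i+1})`. -/
noncomputable def coneFactor (y : Fin (m + 1) → ℝ) : Fin (m + 1) → ℝ[X] :=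
  Fin.cons (C (y 0)) fun i => X - C (y i.succ)

/-- The product of all factors of `y₀ ∏ (X - y_{i+1})` but the `j`-th. -/
noncomputable def coneCofactor (y : Fin (m + 1) → ℝ) (j : Fin (m + 1)) : ℝ[X] :=
  ∏ i ∈ Finset.univ.erase j, coneFactor y i

/-- The derivatives of the factors of `y₀ ∏ (X - y_{i+1})`. -/
def coneSign : Fin (m + 1) → ℝ := Fin.cons 1 fun _ => -1

lemma weightMap_eq_prod (l y : Fin (m + 1) → ℝ) (k : Fin (m + 1)) :
    weightMap l y k = (nodeDen l k)⁻¹ * ∏ i, (coneFactor y i).eval (l k) := by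
  rw [weightMap, Fin.prod_univ_succ, Lagrange.eval_nodal, div_eq_inv_mul]
  simp [coneFactor, Fin.tail]

/-- The Jacobian matrix of `weightMap`. -/
noncomputable def weightJacobian (l y : Fin (m + 1) → ℝ) : Matrix (Fin (m + 1)) (Fin (m + 1)) ℝ :=
  Matrix.of fun k j => (nodeDen l k)⁻¹ * ((coneCofactor y j).eval (l k) * coneSign j)

/-- Each factor depends on one coordinate only, so the product rule gives one cofactor per column.
-/
lemma hasFDerivAt_weightMap (l y : Fin (m + 1) → ℝ) :
    HasFDerivAt (weightMap l) (LinearMap.toContinuousLinearMap (weightJacobian l y).toLin') y := by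
  rw [hasFDerivAt_pi']
  intro k
  have hfac : ∀ i ∈ (Finset.univ : Finset (Fin (m + 1))),
      HasFDerivAt (fun y : Fin (m + 1) → ℝ => (coneFactor y i).eval (l k))
        (coneSign i • ContinuousLinearMap.proj (R := ℝ) (φ := fun _ : Fin (m + 1) => ℝ) i) y := by
    intro i _
    refine Fin.cases ?_ (fun i => ?_) i
    · simpa [coneFactor, coneSign] using
        hasFDerivAt_apply (𝕜 := ℝ) (F' := fun _ : Fin (m + 1) => ℝ) 0 y
    · simpa [coneFactor] using
        ((hasFDerivAt_apply (𝕜 := ℝ) (F' := fun _ : Fin (m + 1) => ℝ) i.succ y).const_sub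
          (l k)).congr_fderiv (g' := coneSign i.succ • ContinuousLinearMap.proj i.succ)
          (by ext; simp [coneSign])
  have h := (HasFDerivAt.finsetProd hfac).const_mul ((nodeDen l k)⁻¹)
  have hfun : (fun y => weightMap l y k) =
      fun y => (nodeDen l k)⁻¹ * ∏ i, (coneFactor y i).eval (l k) :=
    funext fun y => weightMap_eq_prod l y k
  rw [hfun]
  refine h.congr_fderiv ?_
  ext v
  simp only [smul_apply, sum_apply,
    ContinuousLinearMap.proj_apply, ContinuousLinearMap.comp_apply,
    LinearMap.coe_toContinuousLinearMap', Matrix.toLin'_apply, Matrix.mulVec, dotProduct,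
    weightJacobian, Matrix.of_apply, coneCofactor, eval_prod, smul_eq_mul, Finset.mul_sum]
  exact Finset.sum_congr rfl fun _ _ => by ring

lemma coneCofactor_zero (y : Fin (m + 1) → ℝ) :
    coneCofactor y 0 = Lagrange.nodal Finset.univ (Fin.tail y) := by
  rw [coneCofactor, prod_erase_eq_prod_succAbove]
  simp [coneFactor, Lagrange.nodal, Fin.tail]

lemma natDegree_coneFactor_le (y : Fin (m + 1) → ℝ) (i : Fin (m + 1)) :
    (coneFactor y i).natDegree ≤ if i = 0 then 0 else 1 := by
  refine Fin.cases ?_ (fun i => ?_) i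
  · simp [coneFactor]
  · simp [coneFactor]

lemma natDegree_coneCofactor_le (y : Fin (m + 1) → ℝ) (j : Fin (m + 1)) :
    (coneCofactor y j).natDegree ≤ m := by
  refine (natDegree_prod_le _ _).trans ((Finset.sum_le_sum fun i _ =>
    (natDegree_coneFactor_le y i).trans (by split_ifs <;> simp : _ ≤ 1)).trans ?_)
  simp

lemma natDegree_coneCofactor_succ_lt (y : Fin (m + 1) → ℝ) (j : Fin m) :
    (coneCofactor y j.succ).natDegree < m := by
  have hm : 0 < m := j.pos
  refine lt_of_le_of_lt ((natDegree_prod_le _ _).trans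
    (Finset.sum_le_sum fun i _ => natDegree_coneFactor_le y i)) ?_
  have h0 : (0 : Fin (m + 1)) ∈ Finset.univ.erase j.succ :=
    Finset.mem_erase.mpr ⟨(Fin.succ_ne_zero j).symm, Finset.mem_univ _⟩
  rw [← Finset.add_sum_erase _ _ h0]
  have h1 : ∑ i ∈ (Finset.univ.erase j.succ).erase 0, (if i = (0 : Fin (m + 1)) then 0 else 1) ≤
      ∑ i ∈ (Finset.univ.erase j.succ).erase (0 : Fin (m + 1)), 1 :=
    Finset.sum_le_sum fun i _ => by split_ifs <;> simp
  rw [Finset.sum_const, Finset.card_erase_of_mem h0,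
    Finset.card_erase_of_mem (Finset.mem_univ _)] at h1
  simp at h1 ⊢
  omega

lemma eval_coneCofactor_succ_self (y : Fin (m + 1) → ℝ) (i : Fin m) :
    (coneCofactor y i.succ).eval (y i.succ) =
      y 0 * ∏ j ∈ Finset.univ.erase i, (y i.succ - y j.succ) := by
  have h : Finset.univ.erase i.succ =
      insert 0 ((Finset.univ.erase i).map (Fin.succEmb m)) := by
    ext j
    refine Fin.cases ?_ (fun j => ?_) j
    · simp [(Fin.succ_ne_zero i).symm]
    · simp
  rw [coneCofactor, h, Finset.prod_insert (by simp), Finset.prod_map]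
  simp [coneFactor, eval_prod]

lemma eval_coneCofactor_of_ne (y : Fin (m + 1) → ℝ) {i : Fin m} {j : Fin (m + 1)}
    (h : j ≠ i.succ) : (coneCofactor y j).eval (y i.succ) = 0 := by
  rw [coneCofactor, eval_prod]
  exact Finset.prod_eq_zero (Finset.mem_erase.mpr ⟨h.symm, Finset.mem_univ _⟩)
    (by simp [coneFactor])

lemma abs_prod_prod_erase (x : Fin m → ℝ) :
    |∏ i, ∏ j ∈ Finset.univ.erase i, (x i - x j)| = |(Matrix.vandermonde x).det| ^ 2 := by
  have hsplit : ∀ i : Fin m, ∏ j ∈ Finset.univ.erase i, |x i - x j| =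
      (∏ j ∈ Finset.Ioi i, |x i - x j|) * ∏ j ∈ Finset.Iio i, |x i - x j| := by
    intro i
    have h : Finset.univ.erase i = Finset.Ioi i ∪ Finset.Iio i := by
      ext j
      simp only [Finset.mem_erase, Finset.mem_univ, and_true, Finset.mem_union, Finset.mem_Ioi,
        Finset.mem_Iio]
      rw [ne_iff_lt_or_gt, or_comm]
    rw [h, Finset.prod_union]
    exact Finset.disjoint_left.mpr fun j hj hj' =>
      lt_asymm (Finset.mem_Ioi.mp hj) (Finset.mem_Iio.mp hj')
  rw [Matrix.det_vandermonde]
  simp only [Finset.abs_prod, hsplit, Finset.prod_mul_distrib, sq]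
  congr 1
  · exact Finset.prod_congr rfl fun i _ => Finset.prod_congr rfl fun j _ => abs_sub_comm _ _
  · exact Finset.prod_comm' fun i j => by simp

/-- The extra projective node `(1 : 0)` is the point at infinity, whose row reads off the
coefficient of degree `m`. Its factors with the finite nodes are `±1`. -/
lemma abs_det_projVandermonde_cons (x : Fin m → ℝ) :
    |(Matrix.projVandermonde (Fin.cons 1 x : Fin (m + 1) → ℝ) (Fin.cons 0 fun _ => 1)).det| =
      |(Matrix.vandermonde x).det| := by
  rw [Matrix.det_projVandermonde, Fin.prod_univ_succ, abs_mul, Matrix.det_vandermonde]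
  have h1 : |∏ j ∈ Finset.Ioi (0 : Fin (m + 1)),
      ((Fin.cons 1 x : Fin (m + 1) → ℝ) j * (Fin.cons 0 fun _ => 1 : Fin (m + 1) → ℝ) 0 -
        (Fin.cons 1 x : Fin (m + 1) → ℝ) 0 * (Fin.cons 0 fun _ => 1 : Fin (m + 1) → ℝ) j)| = 1 := by
    rw [Finset.abs_prod]
    refine Finset.prod_eq_one fun j hj => ?_
    obtain ⟨j, rfl⟩ := Fin.exists_succ_eq.mpr (Finset.mem_Ioi.mp hj).ne'
    simp
  rw [h1, one_mul]
  congr 1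
  refine Finset.prod_congr rfl fun i _ => ?_
  have h2 : Finset.Ioi i.succ = (Finset.Ioi i).map (Fin.succEmb m) := by
    ext j
    refine Fin.cases ?_ (fun j => ?_) j <;> simp
  rw [h2, Finset.prod_map]
  simp

lemma sum_pow_mul_coeff {p : ℝ[X]} (hp : p.natDegree ≤ m) (t : ℝ) :
    ∑ d : Fin (m + 1), t ^ (d : ℕ) * p.coeff d = p.eval t := by
  rw [eval_eq_sum_range' (Nat.lt_succ_of_le hp), Finset.sum_range]
  exact Finset.sum_congr rfl fun _ _ => mul_comm _ _

/-- Evaluation at a root kills every cofactor that keeps the factor of that root, and the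
coefficient of degree `m` kills every cofactor but the 0-th. The product is therefore diagonal. -/
lemma projVandermonde_mul_coeff (y : Fin (m + 1) → ℝ) :
    Matrix.projVandermonde (Fin.cons 1 (Fin.tail y) : Fin (m + 1) → ℝ) (Fin.cons 0 fun _ => 1) *
        Matrix.of (fun d j : Fin (m + 1) => (coneCofactor y j).coeff d) =
      Matrix.diagonal (Fin.cons 1 fun i =>
        y 0 * ∏ j ∈ Finset.univ.erase i, (Fin.tail y i - Fin.tail y j)) := by
  ext i j
  rw [Matrix.mul_apply, Matrix.diagonal_apply]
  refine Fin.cases ?_ (fun i => ?_) i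
  · rw [Matrix.projVandermonde_apply_zero_right (by simp)]
    rw [Finset.sum_eq_single (Fin.last m) (fun d _ hd => by simp [Pi.single_eq_of_ne hd])
      (by simp)]
    refine Fin.cases ?_ (fun j => ?_) j
    · simp [coneCofactor_zero, coeff_nodal]
    · simp [coeff_eq_zero_of_natDegree_lt (natDegree_coneCofactor_succ_lt y j),
        (Fin.succ_ne_zero j).symm]
  · simp only [Matrix.projVandermonde_apply, Fin.cons_succ, one_pow, mul_one, Matrix.of_apply]
    rw [sum_pow_mul_coeff (natDegree_coneCofactor_le y j)]
    split_ifs with h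
    · rw [← h]
      exact eval_coneCofactor_succ_self y i
    · exact eval_coneCofactor_of_ne y (Ne.symm h)

/-- The diagonal contributes the square of the Vandermonde determinant, and the evaluation matrix
cancels one copy. -/
lemma abs_det_coeff_coneCofactor {y : Fin (m + 1) → ℝ} (hy : 0 ≤ y 0)
    (hinj : Function.Injective (Fin.tail y)) :
    |(Matrix.of fun d j : Fin (m + 1) => (coneCofactor y j).coeff d).det| =
      y 0 ^ m * |(Matrix.vandermonde (Fin.tail y)).det| := by
  have h := congrArg (fun M : Matrix _ _ ℝ => |M.det|) (projVandermonde_mul_coeff y)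
  simp only [Matrix.det_mul, abs_mul, Matrix.det_diagonal, Fin.prod_univ_succ, Fin.cons_zero,
    Fin.cons_succ, one_mul, Finset.prod_mul_distrib, Finset.prod_const, Finset.card_univ,
    Fintype.card_fin, abs_det_projVandermonde_cons, abs_prod_prod_erase] at h
  rw [abs_of_nonneg (pow_nonneg hy m)] at h
  have hV : |(Matrix.vandermonde (Fin.tail y)).det| ≠ 0 :=
    abs_ne_zero.mpr (Matrix.det_vandermonde_ne_zero_iff.mpr hinj)
  refine mul_left_cancel₀ hV (h.trans ?_)
  ring

lemma abs_prod_coneSign : |∏ j : Fin (m + 1), (coneSign j : ℝ)| = 1 := by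
  rw [Finset.abs_prod]
  refine Finset.prod_eq_one fun j _ => ?_
  refine Fin.cases ?_ (fun j => ?_) j <;> simp [coneSign]

/-- The Jacobian determinant of the passage from eigenvalues to weights is, up to a constant,
the Vandermonde determinant of the eigenvalues. -/
lemma abs_det_weightJacobian (hl : StrictAnti l) {y : Fin (m + 1) → ℝ} (hy : y ∈ gapCone l) :
    |(weightJacobian l y).det| =
      |(∏ k, (nodeDen l k)⁻¹) * (Matrix.vandermonde l).det| *
        (y 0 ^ m * |(Matrix.vandermonde (Fin.tail y)).det|) := by
  -- Evaluating the cofactors at the nodes is multiplying their coefficient matrix by the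
  -- Vandermonde matrix of `l`.
  have h : weightJacobian l y = Matrix.diagonal (fun k => (nodeDen l k)⁻¹) *
      (Matrix.vandermonde l * Matrix.of fun d j : Fin (m + 1) => (coneCofactor y j).coeff d) *
        Matrix.diagonal coneSign := by
    ext k j
    rw [Matrix.mul_diagonal, Matrix.diagonal_mul, Matrix.mul_apply]
    simp only [Matrix.vandermonde_apply, Matrix.of_apply]
    rw [sum_pow_mul_coeff (natDegree_coneCofactor_le y j), weightJacobian, Matrix.of_apply]
    ring
  rw [h, Matrix.det_mul, Matrix.det_mul, Matrix.det_mul, Matrix.det_diagonal, Matrix.det_diagonal,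
    abs_mul, abs_mul, abs_mul, abs_prod_coneSign, abs_det_coeff_coneCofactor hy.1.le
      (strictAnti_of_mem_gaps hl (mem_gapBox.mp hy.2)).injective, abs_mul]
  ring

end Jacobian

/-! ### Change of variables from weights to eigenvalues. -/

section ChangeOfVariables

variable {m : ℕ} {l : Fin (m + 1) → ℝ}

lemma measurableSet_gapBox (l : Fin (m + 1) → ℝ) : MeasurableSet (gapBox l) :=
  MeasurableSet.univ_pi fun _ => measurableSet_Ioo

lemma measurable_tail : Measurable (Fin.tail : (Fin (m + 1) → ℝ) → Fin m → ℝ) :=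
  measurable_pi_lambda _ fun _ => measurable_pi_apply _

lemma measurableSet_gapCone (l : Fin (m + 1) → ℝ) : MeasurableSet (gapCone l) :=
  (measurableSet_lt measurable_const (measurable_pi_apply 0)).inter
    (measurable_tail (measurableSet_gapBox l))

/-- A continuous injection on a Borel set is a measurable embedding (Lusin–Souslin). This later
supplies the measurability of the eigenvalues. -/
lemma exists_measurable_leftInverse_weightMap (hl : StrictAnti l) :
    ∃ X : (Fin (m + 1) → ℝ) → Fin m → ℝ, Measurable X ∧
      ∀ y ∈ gapCone l, X (weightMap l y) = Fin.tail y := by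
  have hcont : ContinuousOn (weightMap l) (gapCone l) := fun y _ =>
    (hasFDerivAt_weightMap l y).continuousAt.continuousWithinAt
  obtain ⟨X, hX, hX'⟩ := (hcont.measurableEmbedding (measurableSet_gapCone l)
    (weightMap_injOn hl)).exists_measurable_extend
    (g := fun y : gapCone l => Fin.tail (y : Fin (m + 1) → ℝ))
    (measurable_tail.comp measurable_subtype_coe) (fun _ => inferInstance)
  exact ⟨X, hX, fun y hy => congrFun hX' ⟨y, hy⟩⟩

lemma measurable_abs_det_vandermonde :
    Measurable fun x : Fin m → ℝ => ENNReal.ofReal |(Matrix.vandermonde x).det| := by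
  have h : Continuous fun x : Fin m → ℝ => |(Matrix.vandermonde x).det| :=
    (Continuous.matrix_det (continuous_pi fun i => continuous_pi fun j => by
      simp only [Matrix.vandermonde_apply]; fun_prop)).abs
  exact h.measurable.ennreal_ofReal

/-- The open corner `{e > 0, ∑ e < 1}`, in eigenvalue coordinates. -/
lemma exists_setLIntegral_corner_eq (hl : StrictAnti l) :
    ∃ c : ENNReal, c ≠ ⊤ ∧ ∀ X : (Fin (m + 1) → ℝ) → Fin m → ℝ,
      (∀ y ∈ gapCone l, X (weightMap l y) = Fin.tail y) →
      ∀ F : (Fin m → ℝ) → ENNReal, Measurable F →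
        ∫⁻ e in {e : Fin (m + 1) → ℝ | (∀ k, 0 < e k) ∧ ∑ k, e k < 1}, F (X e) =
          c * ∫⁻ x in gapBox l, ENNReal.ofReal |(Matrix.vandermonde x).det| * F x := by
  set a := |(∏ k, (nodeDen l k)⁻¹) * (Matrix.vandermonde l).det| with ha
  -- The constant part of the Jacobian times the integral over the scale, which separates from the
  -- roots.
  refine ⟨ENNReal.ofReal a * ∫⁻ s in Set.Ioo (0 : ℝ) 1, ENNReal.ofReal (s ^ m), ?_, ?_⟩
  · refine ENNReal.mul_ne_top ENNReal.ofReal_ne_top (ne_of_lt ?_)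
    calc ∫⁻ s in Set.Ioo (0 : ℝ) 1, ENNReal.ofReal (s ^ m)
        ≤ ∫⁻ _ in Set.Ioo (0 : ℝ) 1, 1 := by
          refine setLIntegral_mono measurable_const fun s hs => ?_
          rw [← ENNReal.ofReal_one]
          exact ENNReal.ofReal_le_ofReal (pow_le_one₀ hs.1.le hs.2.le)
      _ < ⊤ := by simp
  intro X hX F hF
  have hmeas : MeasurableSet (gapCone l ∩ {y | y 0 < 1}) :=
    (measurableSet_gapCone l).inter (measurableSet_lt (measurable_pi_apply 0) measurable_const)
  rw [← image_weightMap hl, lintegral_image_eq_lintegral_abs_det_fderiv_mul volume hmeas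
    (fun y _ => (hasFDerivAt_weightMap l y).hasFDerivWithinAt)
    ((weightMap_injOn hl).mono Set.inter_subset_left)]
  have hpre : gapCone l ∩ {y | y 0 < 1} =
      MeasurableEquiv.piFinSuccAbove (fun _ => ℝ) 0 ⁻¹' (Set.Ioo (0 : ℝ) 1 ×ˢ gapBox l) := by
    ext y
    simp only [gapCone, Set.mem_inter_iff, Set.mem_ofPred_eq, Set.mem_preimage, Set.mem_prod,
      Set.mem_Ioo, MeasurableEquiv.piFinSuccAbove_apply, Fin.insertNthEquiv_symm_apply]
    have : Fin.removeNth 0 y = Fin.tail y := rfl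
    rw [this]
    tauto
  have hcongr : ∀ y ∈ gapCone l ∩ {y | y 0 < 1},
      ENNReal.ofReal |(LinearMap.toContinuousLinearMap (weightJacobian l y).toLin').det| *
          F (X (weightMap l y)) =
        (fun p : ℝ × (Fin m → ℝ) => (ENNReal.ofReal a * ENNReal.ofReal (p.1 ^ m)) *
          (ENNReal.ofReal |(Matrix.vandermonde p.2).det| * F p.2))
          (MeasurableEquiv.piFinSuccAbove (fun _ => ℝ) 0 y) := by
    intro y hy
    have hdet : (LinearMap.toContinuousLinearMap (weightJacobian l y).toLin').det =
        (weightJacobian l y).det := LinearMap.det_toLin' _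
    rw [hdet, abs_det_weightJacobian hl hy.1, hX y hy.1, ENNReal.ofReal_mul (abs_nonneg _),
      ENNReal.ofReal_mul (pow_nonneg hy.1.1.le m)]
    have : (MeasurableEquiv.piFinSuccAbove (fun _ => ℝ) 0) y = (y 0, Fin.tail y) := rfl
    rw [this]
    ring
  have hmp := volume_preserving_piFinSuccAbove (fun _ : Fin (m + 1) => ℝ) 0
  have hG : Measurable fun p : ℝ × (Fin m → ℝ) => (ENNReal.ofReal a * ENNReal.ofReal (p.1 ^ m)) *
      (ENNReal.ofReal |(Matrix.vandermonde p.2).det| * F p.2) :=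
    (by fun_prop : Measurable fun p : ℝ × (Fin m → ℝ) =>
      ENNReal.ofReal a * ENNReal.ofReal (p.1 ^ m)).mul
        ((measurable_abs_det_vandermonde.comp measurable_snd).mul (hF.comp measurable_snd))
  rw [setLIntegral_congr_fun hmeas hcongr, hpre]
  refine (hmp.setLIntegral_comp_preimage (measurableSet_Ioo.prod (measurableSet_gapBox l))
    hG).trans ?_
  rw [Measure.volume_eq_prod, ← Measure.prod_restrict]
  rw [← lintegral_const_mul (f := fun s : ℝ => ENNReal.ofReal (s ^ m)) _ (by fun_prop)]
  refine lintegral_prod_mul (f := fun s : ℝ => ENNReal.ofReal a * ENNReal.ofReal (s ^ m))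
    (g := fun x => ENNReal.ofReal |(Matrix.vandermonde x).det| * F x) ?_ ?_
  · exact (by fun_prop : Measurable fun s : ℝ =>
      ENNReal.ofReal a * ENNReal.ofReal (s ^ m)).aemeasurable
  · exact (measurable_abs_det_vandermonde.mul hF).aemeasurable

end ChangeOfVariables

/-! ### Squared moduli of a uniform point of the complex ball. -/

section NormSq

/-- The disc of radius `√t` has area `π t`, linear in `t`. -/
lemma Complex.map_normSq_volume :
    (volume : Measure ℂ).map Complex.normSq =
      ENNReal.ofReal Real.pi • (volume : Measure ℝ).restrict (Set.Ioi 0) := by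
  have hIio : ∀ t : ℝ, volume (Complex.normSq ⁻¹' Set.Iio t) = ENNReal.ofReal (Real.pi * t) := by
    intro t
    rcases le_or_gt t 0 with ht | ht
    · have h : Complex.normSq ⁻¹' Set.Iio t = ∅ := by
        ext z
        simpa using ht.trans (Complex.normSq_nonneg z)
      rw [h, measure_empty, ENNReal.ofReal_of_nonpos (mul_nonpos_of_nonneg_of_nonpos
        Real.pi_pos.le ht)]
    · have h : Complex.normSq ⁻¹' Set.Iio t = Metric.ball 0 (Real.sqrt t) := by
        ext z
        rw [Set.mem_preimage, Set.mem_Iio, mem_ball_zero_iff, Real.lt_sqrt (norm_nonneg z),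
          Complex.normSq_eq_norm_sq]
      rw [h, Complex.volume_ball, ← ENNReal.ofReal_pow (Real.sqrt_nonneg t), Real.sq_sqrt ht.le,
        mul_comm, ENNReal.ofReal_mul Real.pi_pos.le]
      congr 1
      rw [← NNReal.coe_real_pi, ENNReal.ofReal_coe_nnreal]
  have hm : Measurable Complex.normSq := Complex.continuous_normSq.measurable
  have hL : ∀ t : ℝ, (volume : Measure ℂ).map Complex.normSq (Set.Iio t) =
      ENNReal.ofReal (Real.pi * t) := fun t => by
    rw [Measure.map_apply hm measurableSet_Iio, hIio]
  have hR : ∀ t : ℝ, (ENNReal.ofReal Real.pi • (volume : Measure ℝ).restrict (Set.Ioi 0))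
      (Set.Iio t) = ENNReal.ofReal (Real.pi * t) := fun t => by
    rw [Measure.smul_apply, Measure.restrict_apply measurableSet_Iio, Set.inter_comm,
      Set.Ioi_inter_Iio, Real.volume_Ioo, sub_zero, smul_eq_mul, ENNReal.ofReal_mul Real.pi_pos.le]
  have hIco : ∀ μ : Measure ℝ, (∀ t, μ (Set.Iio t) = ENNReal.ofReal (Real.pi * t)) →
      ∀ ⦃a b : ℝ⦄, a < b →
        μ (Set.Ico a b) = ENNReal.ofReal (Real.pi * b) - ENNReal.ofReal (Real.pi * a) := by
    intro μ hμ a b hab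
    have h : Set.Ico a b = Set.Iio b \ Set.Iio a := by
      ext x
      simp
    rw [h, measure_sdiff (Set.Iio_subset_Iio hab.le) measurableSet_Iio.nullMeasurableSet
      (by rw [hμ]; exact ENNReal.ofReal_ne_top), hμ, hμ]
  refine Measure.ext_of_Ico' _ _ (fun a b hab => ?_) (fun a b hab => ?_)
  · rw [hIco _ hL hab]
    exact ENNReal.sub_ne_top ENNReal.ofReal_ne_top
  · rw [hIco _ hL hab, hIco _ hR hab]

/-- Integration over the unit ball of `ℂⁿ` of a function of the squared moduli. -/
lemma setLIntegral_normSq (n : ℕ) {F : (Fin n → ℝ) → ENNReal} (hF : Measurable F) :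
    ∫⁻ z in {z : Fin n → ℂ | ∑ k, Complex.normSq (z k) < 1}, F (fun k => Complex.normSq (z k)) =
      ENNReal.ofReal Real.pi ^ n *
        ∫⁻ e in {e : Fin n → ℝ | (∀ k, 0 < e k) ∧ ∑ k, e k < 1}, F e := by
  have hm : Measurable Complex.normSq := Complex.continuous_normSq.measurable
  have hmp : MeasurePreserving (fun (z : Fin n → ℂ) k => Complex.normSq (z k)) volume
      (ENNReal.ofReal Real.pi ^ n •
        (volume : Measure (Fin n → ℝ)).restrict (Set.univ.pi fun _ => Set.Ioi 0)) := by
    have hσ : SigmaFinite ((volume : Measure ℂ).map Complex.normSq) := by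
      rw [Complex.map_normSq_volume]
      exact SMul.sigmaFinite (Real.toNNReal Real.pi)
    have h := measurePreserving_pi (fun _ : Fin n => (volume : Measure ℂ))
      (fun _ => (volume : Measure ℂ).map Complex.normSq)
      (fun _ => ⟨hm, rfl⟩)
    have hν : Measure.pi (fun _ : Fin n => (volume : Measure ℂ).map Complex.normSq) =
        ENNReal.ofReal Real.pi ^ n •
          (volume : Measure (Fin n → ℝ)).restrict (Set.univ.pi fun _ => Set.Ioi 0) := by
      rw [volume_pi, Measure.restrict_pi_pi]
      refine Measure.pi_eq fun s _ => ?_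
      rw [Complex.map_normSq_volume]
      simp [Measure.pi_pi, Finset.prod_mul_distrib]
    rwa [hν] at h
  have hs : MeasurableSet {e : Fin n → ℝ | ∑ k, e k < 1} :=
    measurableSet_lt (by fun_prop) measurable_const
  have h := hmp.setLIntegral_comp_preimage hs hF
  rw [Measure.restrict_smul, Measure.restrict_restrict hs, lintegral_smul_measure,
    smul_eq_mul] at h
  have hset : {e : Fin n → ℝ | (∀ k, 0 < e k) ∧ ∑ k, e k < 1} =
      {e | ∑ k, e k < 1} ∩ Set.univ.pi fun _ => Set.Ioi 0 := by
    ext e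
    simp [and_comm]
  rw [hset]
  exact h

end NormSq

/-! ### A row of a Haar unitary matrix. -/

section HaarRow

variable {n : ℕ}

lemma measurable_matrix_entry {n : ℕ} (i j : Fin n) :
    Measurable fun M : Matrix (Fin n) (Fin n) ℂ => M i j :=
  (by fun_prop : Measurable fun M : Fin n → Fin n → ℂ => M i j)

/-- The open unit ball of `ℂⁿ`. -/
def complexBall (n : ℕ) : Set (Fin n → ℂ) := {z | ∑ k, Complex.normSq (z k) < 1}

lemma sum_normSq_eq_dotProduct (z : Fin n → ℂ) :
    ((∑ k, Complex.normSq (z k) : ℝ) : ℂ) = dotProduct z (star z) := by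
  simp [dotProduct, Complex.mul_conj]

lemma sum_normSq_vecMul (U : Matrix.unitaryGroup (Fin n) ℂ) (z : Fin n → ℂ) :
    ∑ k, Complex.normSq (Matrix.vecMul z (U : Matrix (Fin n) (Fin n) ℂ) k) =
      ∑ k, Complex.normSq (z k) := by
  have h : ((∑ k, Complex.normSq (Matrix.vecMul z (U : Matrix (Fin n) (Fin n) ℂ) k) : ℝ) : ℂ) =
      ((∑ k, Complex.normSq (z k) : ℝ) : ℂ) := by
    rw [sum_normSq_eq_dotProduct, sum_normSq_eq_dotProduct, Matrix.star_vecMul,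
      Matrix.dotProduct_mulVec, Matrix.vecMul_vecMul, ← Matrix.star_eq_conjTranspose,
      Matrix.mem_unitaryGroup_iff.mp U.2, Matrix.vecMul_one]
  exact_mod_cast h

lemma isOpen_complexBall (n : ℕ) : IsOpen (complexBall n) :=
  isOpen_lt (continuous_finsetSum _ fun k _ =>
    Complex.continuous_normSq.comp (continuous_apply k)) continuous_const

lemma volume_complexBall_ne_zero (n : ℕ) : volume (complexBall n) ≠ 0 :=
  ((isOpen_complexBall n).measure_pos volume ⟨0, by simp [complexBall]⟩).ne'

lemma volume_complexBall_ne_top (n : ℕ) : volume (complexBall n) ≠ ⊤ := by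
  refine ((measure_mono fun z hz => ?_).trans_lt
    (measure_ball_lt_top (x := (0 : Fin n → ℂ)) (r := 1))).ne
  rw [mem_ball_zero_iff, pi_norm_lt_iff one_pos]
  intro k
  have h1 : Complex.normSq (z k) ≤ ∑ k, Complex.normSq (z k) :=
    Finset.single_le_sum (f := fun k => Complex.normSq (z k))
      (fun k _ => Complex.normSq_nonneg _) (Finset.mem_univ k)
  have h2 : ∑ k, Complex.normSq (z k) < 1 := hz
  rw [Complex.normSq_eq_norm_sq] at h1
  nlinarith [norm_nonneg (z k)]

lemma preimage_vecMul_complexBall (U : Matrix.unitaryGroup (Fin n) ℂ) :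
    (fun z : Fin n → ℂ => Matrix.vecMul z (U : Matrix (Fin n) (Fin n) ℂ)) ⁻¹' complexBall n =
      complexBall n := by
  ext z
  simp only [Set.mem_preimage, complexBall, Set.mem_ofPred_eq, sum_normSq_vecMul]

/-- Unitary matrices preserve Lebesgue measure on `ℂⁿ`. -/
lemma measurePreserving_vecMul (U : Matrix.unitaryGroup (Fin n) ℂ) :
    MeasurePreserving fun z : Fin n → ℂ => Matrix.vecMul z (U : Matrix (Fin n) (Fin n) ℂ) := by
  have hcont : ∀ V : Matrix.unitaryGroup (Fin n) ℂ,
      Continuous fun z : Fin n → ℂ => Matrix.vecMul z (V : Matrix (Fin n) (Fin n) ℂ) :=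
    fun V => continuous_id.matrix_vecMul continuous_const
  let e : (Fin n → ℂ) ≃ₗ[ℝ] (Fin n → ℂ) :=
    { toFun := fun z => Matrix.vecMul z (U : Matrix (Fin n) (Fin n) ℂ)
      invFun := fun z => Matrix.vecMul z (U⁻¹ : Matrix.unitaryGroup (Fin n) ℂ).1
      map_add' := fun z w => Matrix.add_vecMul _ z w
      map_smul' := fun c z => by rw [RingHom.id_apply]; exact Matrix.smul_vecMul c z _
      left_inv := fun z => by
        simp [Matrix.vecMul_vecMul, Matrix.mem_unitaryGroup_iff.mp U.2]
      right_inv := fun z => by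
        simp [Matrix.vecMul_vecMul, Matrix.mem_unitaryGroup_iff'.mp U.2] }
  have hmap : (volume.map e : Measure (Fin n → ℂ)).IsAddHaarMeasure :=
    e.toContinuousLinearEquiv.isAddHaarMeasure_map volume
  refine ⟨(hcont U).measurable, ?_⟩
  -- The image is a multiple of Lebesgue measure by uniqueness of Haar measure. The invariant unit
  -- ball forces the factor to be 1.
  have hc := Measure.isAddLeftInvariant_eq_smul (volume.map e : Measure (Fin n → ℂ)) volume
  set c := Measure.addHaarScalarFactor (volume.map e : Measure (Fin n → ℂ)) volume
  have hball := congrArg (fun μ : Measure (Fin n → ℂ) => μ (complexBall n)) hc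
  have hpre : e ⁻¹' complexBall n = complexBall n := preimage_vecMul_complexBall U
  simp only [Measure.smul_apply, ENNReal.smul_def, smul_eq_mul] at hball
  rw [Measure.map_apply (show Measurable e from (hcont U).measurable)
    (isOpen_complexBall n).measurableSet, hpre] at hball
  have hc1 : (c : ENNReal) = 1 := (ENNReal.mul_left_inj (volume_complexBall_ne_zero n)
    (volume_complexBall_ne_top n)).mp (hball.symm.trans (one_mul _).symm)
  rw [ENNReal.coe_eq_one.mp hc1, one_smul] at hc
  exact hc

/-- The unitary group acts transitively on rays of `ℂⁿ`. -/
lemma exists_unitary_row_eq (r : Fin n) {z : Fin n → ℂ} (hz : z ≠ 0) :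
    ∃ V : Matrix.unitaryGroup (Fin n) ℂ, ∃ t : ℝ, 0 < t ∧
      z = (t : ℂ) • (V : Matrix (Fin n) (Fin n) ℂ) r := by
  set w : EuclideanSpace ℂ (Fin n) := WithLp.toLp 2 z with hw
  have hw0 : w ≠ 0 := fun h => hz (by rw [hw] at h; simpa using h)
  have ht : 0 < ‖w‖ := norm_pos_iff.mpr hw0
  have hort : Orthonormal ℂ (({r} : Set (Fin n)).domRestrict fun _ => ((‖w‖⁻¹ : ℝ) : ℂ) • w) := by
    constructor
    · intro i
      simp [norm_smul, ht.ne']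
    · intro i j hij
      exact absurd (Subsingleton.elim i j) hij
  obtain ⟨b, hb⟩ := hort.exists_orthonormalBasis_extension_of_card_eq (by simp)
  have hV : (Matrix.of fun i j => b i j) ∈ Matrix.unitaryGroup (Fin n) ℂ := by
    rw [Matrix.mem_unitaryGroup_iff]
    ext i k
    have h := (orthonormal_iff_ite.mp b.orthonormal) k i
    rw [PiLp.inner_apply] at h
    simp only [Matrix.mul_apply, Matrix.of_apply, Matrix.star_apply, Matrix.one_apply]
    simpa [eq_comm] using h
  refine ⟨⟨_, hV⟩, ‖w‖, ht, ?_⟩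
  have hbr := hb r rfl
  funext k
  have := congrArg (fun v : EuclideanSpace ℂ (Fin n) => v k) hbr
  simp only [PiLp.smul_apply, smul_eq_mul] at this
  simp only [Pi.smul_apply, Matrix.of_apply, smul_eq_mul]
  rw [this, ← mul_assoc, ← Complex.ofReal_mul, mul_inv_cancel₀ ht.ne', Complex.ofReal_one, one_mul]

instance haarUnitary_isProbabilityMeasure (n : ℕ) : IsProbabilityMeasure (haarUnitary n) :=
  ⟨Measure.haarMeasure_self⟩

instance haarUnitary_isMulLeftInvariant (n : ℕ) : (haarUnitary n).IsMulLeftInvariant :=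
  inferInstanceAs (Measure.haarMeasure ⊤).IsMulLeftInvariant

/-- A row of a Haar unitary matrix has the direction of a uniform point of the unit ball. -/
lemma setLIntegral_complexBall_eq (r : Fin n) {H : (Fin n → ℂ) → ENNReal} (hH : Measurable H)
    (hscale : ∀ (t : ℝ) (z : Fin n → ℂ), 0 < t → H ((t : ℂ) • z) = H z) :
    ∫⁻ z in complexBall n, H z =
      volume (complexBall n) *
        ∫⁻ U : Matrix.unitaryGroup (Fin n) ℂ, H ((U : Matrix (Fin n) (Fin n) ℂ) r) ∂haarUnitary n := by
  have hball := (isOpen_complexBall n).measurableSet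
  have hentry : ∀ i j, Measurable fun U : Matrix.unitaryGroup (Fin n) ℂ =>
      (U : Matrix (Fin n) (Fin n) ℂ) i j := fun i j =>
    (measurable_matrix_entry i j).comp measurable_subtype_coe
  have hmeas : Measurable fun p : Matrix.unitaryGroup (Fin n) ℂ × (Fin n → ℂ) =>
      H (Matrix.vecMul p.2 (p.1 : Matrix (Fin n) (Fin n) ℂ)) := by
    refine hH.comp (measurable_pi_lambda _ fun j => ?_)
    simp only [Matrix.vecMul, dotProduct]
    exact Finset.measurable_sum _ fun i _ =>
      ((measurable_pi_apply i).comp measurable_snd).mul ((hentry i j).comp measurable_fst)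
  have hpres : ∀ U : Matrix.unitaryGroup (Fin n) ℂ,
      ∫⁻ z in complexBall n, H (Matrix.vecMul z (U : Matrix (Fin n) (Fin n) ℂ)) =
        ∫⁻ z in complexBall n, H z := by
    intro U
    have h := (measurePreserving_vecMul U).setLIntegral_comp_preimage hball hH
    rwa [preimage_vecMul_complexBall] at h
  have hinv : ∀ z : Fin n → ℂ, z ≠ 0 →
      ∫⁻ U, H (Matrix.vecMul z (U : Matrix (Fin n) (Fin n) ℂ)) ∂haarUnitary n =
        ∫⁻ U : Matrix.unitaryGroup (Fin n) ℂ, H ((U : Matrix (Fin n) (Fin n) ℂ) r) ∂haarUnitary n := by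
    intro z hz
    obtain ⟨V, t, ht, hzV⟩ := exists_unitary_row_eq r hz
    -- Row `r` of `V * U` is row `r` of `V` times `U`, so left invariance absorbs `V`.
    refine Eq.trans (lintegral_congr fun U => ?_) (lintegral_mul_left_eq_self
      (fun U : Matrix.unitaryGroup (Fin n) ℂ => H ((U : Matrix (Fin n) (Fin n) ℂ) r)) V)
    rw [hzV, Matrix.smul_vecMul, hscale t _ ht]
    rfl
  have hne : ∀ᵐ z : Fin n → ℂ ∂volume.restrict (complexBall n), z ≠ 0 := by
    -- The index `r` guarantees positive dimension, so the origin is null.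
    have : NullSingletonClass (volume : Measure (Fin n → ℂ)) := Measure.pi_nullSingletonClass r
    exact ae_restrict_of_ae (Measure.ae_ne volume 0)
  calc ∫⁻ z in complexBall n, H z
      = ∫⁻ U : Matrix.unitaryGroup (Fin n) ℂ, (∫⁻ z in complexBall n,
          H (Matrix.vecMul z (U : Matrix (Fin n) (Fin n) ℂ))) ∂haarUnitary n := by simp [hpres]
    _ = ∫⁻ z in complexBall n, (∫⁻ U : Matrix.unitaryGroup (Fin n) ℂ,
          H (Matrix.vecMul z (U : Matrix (Fin n) (Fin n) ℂ)) ∂haarUnitary n) := lintegral_lintegral_swap hmeas.aemeasurable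
    _ = ∫⁻ _ in complexBall n, (∫⁻ U : Matrix.unitaryGroup (Fin n) ℂ,
          H ((U : Matrix (Fin n) (Fin n) ℂ) r) ∂haarUnitary n) :=
        lintegral_congr_ae (hne.mono fun z hz => hinv z hz)
    _ = _ := by rw [setLIntegral_const, mul_comm]

end HaarRow

/-! ### The characteristic polynomial of the minor. -/

section Minor

variable {m : ℕ} {l : Fin (m + 1) → ℝ}

/-- The coefficients of the characteristic polynomial of the top left minor of `A` in the basis
`∏_{k ≠ i} (X - l_k)`. -/
noncomputable def minorWeight (l : Fin (m + 1) → ℝ) (A : Matrix (Fin (m + 1)) (Fin (m + 1)) ℂ)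
    (k : Fin (m + 1)) : ℝ :=
  (Matrix.scalar (Fin m) (l k : ℂ) - A.submatrix Fin.castSucc Fin.castSucc).det.re / nodeDen l k

lemma measurable_minorWeight (l : Fin (m + 1) → ℝ) : Measurable (minorWeight l) := by
  refine measurable_pi_lambda _ fun k => Measurable.div_const ?_ _
  refine (Complex.continuous_re.comp (Continuous.matrix_det ?_)).measurable
  exact continuous_const.sub (continuous_id.matrix_submatrix _ _)

/-- For unitary `V` the adjugate is `det V • star V`; the determinants of `V` and `star V` cancel.
-/
lemma adjugate_unitary_conj {n : ℕ} (U : Matrix.unitaryGroup (Fin n) ℂ)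
    (E : Matrix (Fin n) (Fin n) ℂ) :
    ((U : Matrix (Fin n) (Fin n) ℂ) * E * star (U : Matrix (Fin n) (Fin n) ℂ)).adjugate =
      (U : Matrix (Fin n) (Fin n) ℂ) * E.adjugate * star (U : Matrix (Fin n) (Fin n) ℂ) := by
  set V : Matrix (Fin n) (Fin n) ℂ := U.val
  have h1 : V * star V = 1 := Matrix.mem_unitaryGroup_iff.mp U.2
  have h2 : star V * V = 1 := Matrix.mem_unitaryGroup_iff'.mp U.2
  have hV : V.adjugate = V.det • star V := by
    calc V.adjugate = star V * (V * V.adjugate) := by rw [← mul_assoc, h2, one_mul]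
      _ = V.det • star V := by rw [Matrix.mul_adjugate, Matrix.mul_smul, mul_one]
  have hV' : (star V).adjugate = (star V).det • V := by
    calc (star V).adjugate = V * (star V * (star V).adjugate) := by rw [← mul_assoc, h1, one_mul]
      _ = (star V).det • V := by rw [Matrix.mul_adjugate, Matrix.mul_smul, mul_one]
  have hdet : (star V).det * V.det = 1 := by rw [← Matrix.det_mul, h2, Matrix.det_one]
  rw [Matrix.adjugate_mul_distrib, Matrix.adjugate_mul_distrib, hV, hV', Matrix.mul_smul,
    Matrix.smul_mul, Matrix.mul_smul, smul_smul, hdet, one_smul, ← mul_assoc]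

/-- The determinant for the minor is the last diagonal entry of the adjugate of `l k - A`. After
diagonalisation this adjugate has a single nonzero entry, `nodeDen l k` at position `k`. -/
lemma minorWeight_unitary_conj (hl : StrictAnti l) (U : Matrix.unitaryGroup (Fin (m + 1)) ℂ)
    (k : Fin (m + 1)) :
    minorWeight l ((U : Matrix (Fin (m + 1)) (Fin (m + 1)) ℂ) *
        Matrix.diagonal (fun i => (l i : ℂ)) *
          star (U : Matrix (Fin (m + 1)) (Fin (m + 1)) ℂ)) k =
      Complex.normSq ((U : Matrix (Fin (m + 1)) (Fin (m + 1)) ℂ) (Fin.last m) k) := by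
  set V : Matrix (Fin (m + 1)) (Fin (m + 1)) ℂ := U.val with hVU
  have h1 : V * star V = 1 := Matrix.mem_unitaryGroup_iff.mp U.2
  set A := V * Matrix.diagonal (fun i => (l i : ℂ)) * star V
  have hconj : Matrix.scalar (Fin (m + 1)) (l k : ℂ) - A =
      V * Matrix.diagonal (fun i => (l k : ℂ) - l i) * star V := by
    have hd : Matrix.diagonal (fun i => (l k : ℂ) - l i) =
        Matrix.scalar (Fin (m + 1)) (l k : ℂ) - Matrix.diagonal (fun i => (l i : ℂ)) := by
      rw [Matrix.scalar_apply, Matrix.diagonal_sub]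
    rw [hd, mul_sub, sub_mul, (Matrix.scalar_commute (l k : ℂ) (fun r => mul_comm _ r) V).symm.eq,
      mul_assoc, h1, mul_one]
  have hsub : Matrix.scalar (Fin m) (l k : ℂ) - A.submatrix Fin.castSucc Fin.castSucc =
      (Matrix.scalar (Fin (m + 1)) (l k : ℂ) - A).submatrix Fin.castSucc Fin.castSucc := by
    ext i j
    simp [Matrix.diagonal_apply]
  have hadj := Matrix.adjugate_fin_succ_eq_det_submatrix
    (Matrix.scalar (Fin (m + 1)) (l k : ℂ) - A) (Fin.last m) (Fin.last m)
  rw [Fin.succAbove_last, ← two_mul, pow_mul, neg_one_sq, one_pow, one_mul, ← hsub, hconj, hVU,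
    adjugate_unitary_conj, ← hVU, Matrix.adjugate_diagonal, Matrix.mul_apply] at hadj
  have hsum : ∑ j, (V * Matrix.diagonal fun i =>
      ∏ j ∈ Finset.univ.erase i, ((l k : ℂ) - l j)) (Fin.last m) j * star V j (Fin.last m) =
        ((Complex.normSq (V (Fin.last m) k) * nodeDen l k : ℝ) : ℂ) := by
    rw [Finset.sum_eq_single k]
    · rw [Matrix.mul_diagonal, Matrix.star_apply, mul_right_comm, nodeDen]
      push_cast
      rw [← Complex.mul_conj]
      rfl
    · intro j _ hj
      rw [Matrix.mul_diagonal, Finset.prod_eq_zero (Finset.mem_erase.mpr ⟨hj.symm,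
        Finset.mem_univ k⟩) (sub_self _), mul_zero, zero_mul]
    · simp
  rw [minorWeight, ← hadj, hsum, Complex.ofReal_re,
    mul_div_cancel_right₀ _ (nodeDen_ne_zero hl.injective k)]

lemma minorEigenvalue_antitone {A : Matrix (Fin (m + 1)) (Fin (m + 1)) ℂ} (hA : A.IsHermitian) :
    Antitone (minorEigenvalue hA) := fun _ _ hij =>
  Matrix.IsHermitian.eigenvalues₀_antitone _ hij

/-- If all the weights are positive, they determine the eigenvalues of the minor, which lie in the
gaps of `l`. -/
lemma exists_weightMap_eq_minorWeight (hl : StrictAnti l)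
    {A : Matrix (Fin (m + 1)) (Fin (m + 1)) ℂ} (hA : A.IsHermitian)
    (hpos : ∀ k, 0 < minorWeight l A k) :
    ∃ y ∈ gapCone l, weightMap l y = minorWeight l A ∧ Fin.tail y = minorEigenvalue hA := by
  obtain ⟨y, hy, hyw⟩ := exists_weightMap_eq hl hpos
  refine ⟨y, hy, hyw, ?_⟩
  have hB := hA.submatrix (Fin.castSucc : Fin m → Fin (m + 1))
  have heval : ∀ k, (Matrix.scalar (Fin m) (l k : ℂ) -
      A.submatrix Fin.castSucc Fin.castSucc).det.re =
        (Lagrange.nodal Finset.univ hB.eigenvalues).eval (l k) := by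
    intro k
    rw [← Matrix.eval_charpoly, hB.charpoly_eq, eval_prod, Lagrange.eval_nodal,
      ← Complex.ofReal_re (∏ i, (l k - hB.eigenvalues i))]
    congr 1
    push_cast
    simp
  have hpoly : C (y 0) * Lagrange.nodal Finset.univ (Fin.tail y) =
      Lagrange.nodal Finset.univ hB.eigenvalues := by
    refine eq_of_eval_nodes_eq hl.injective (natDegree_C_mul_nodal_le _ _)
      (by simp [Lagrange.natDegree_nodal]) fun k => ?_
    have h := congrFun hyw k
    rw [weightMap, minorWeight, div_left_inj' (nodeDen_ne_zero hl.injective k), heval] at h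
    rw [eval_mul, eval_C, h]
  have hex : ∀ i, ∃ j, Fin.tail y i = minorEigenvalue hA j := by
    intro i
    have h0 : (Lagrange.nodal Finset.univ hB.eigenvalues).eval (Fin.tail y i) = 0 := by
      rw [← hpoly, eval_mul, Lagrange.eval_nodal_at_node (Finset.mem_univ i), mul_zero]
    rw [Lagrange.eval_nodal, Finset.prod_eq_zero_iff] at h0
    obtain ⟨j, -, hj⟩ := h0
    exact ⟨Fin.cast (Fintype.card_fin m) ((Fintype.equivOfCardEq (Fintype.card_fin _)).symm j),
      sub_eq_zero.mp hj⟩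
  choose τ hτ using hex
  have hanti := strictAnti_of_mem_gaps hl (mem_gapBox.mp hy.2)
  -- Roots strictly decrease and eigenvalues are antitone, so `τ` is a strictly increasing self-map
  -- of `Fin m`, hence the identity. No multiplicities need to be counted.
  have hmono : StrictMono τ := fun i j hij =>
    (minorEigenvalue_antitone hA).reflect_lt (by rw [← hτ, ← hτ]; exact hanti hij)
  have hid : τ = id := hmono.eq_id
  funext i
  rw [hτ, hid, id]

end Minor

/-! ### The law of the eigenvalues of the minor. -/

section Law

variable {m : ℕ} {l : Fin (m + 1) → ℝ}

/-- The squared moduli of the last row of a unitary matrix. -/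
def lastRowWeight (U : Matrix.unitaryGroup (Fin (m + 1)) ℂ) (k : Fin (m + 1)) : ℝ :=
  Complex.normSq ((U : Matrix (Fin (m + 1)) (Fin (m + 1)) ℂ) (Fin.last m) k)

lemma measurable_lastRowWeight : Measurable (lastRowWeight (m := m)) :=
  measurable_pi_lambda _ fun k => Complex.continuous_normSq.measurable.comp
    ((measurable_matrix_entry _ k).comp measurable_subtype_coe)

lemma measurable_unitary_conj (l : Fin (m + 1) → ℝ) :
    Measurable fun U : Matrix.unitaryGroup (Fin (m + 1)) ℂ =>
      (U : Matrix (Fin (m + 1)) (Fin (m + 1)) ℂ) * Matrix.diagonal (fun i => (l i : ℂ)) *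
        star (U : Matrix (Fin (m + 1)) (Fin (m + 1)) ℂ) :=
  ((continuous_subtype_val.mul continuous_const).mul continuous_subtype_val.star).measurable

/-- Integration of a scale invariant function of the squared moduli of the last row. -/
lemma lintegral_lastRowWeight {G : (Fin (m + 1) → ℝ) → ENNReal} (hG : Measurable G)
    (hscale : ∀ (t : ℝ) (e : Fin (m + 1) → ℝ), 0 < t → G (t • e) = G e) :
    volume (complexBall (m + 1)) * ∫⁻ U, G (lastRowWeight U) ∂haarUnitary (m + 1) =
      ENNReal.ofReal Real.pi ^ (m + 1) *
        ∫⁻ e in {e : Fin (m + 1) → ℝ | (∀ k, 0 < e k) ∧ ∑ k, e k < 1}, G e := by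
  rw [← setLIntegral_normSq _ hG]
  refine (setLIntegral_complexBall_eq (Fin.last m)
    (H := fun z => G fun k => Complex.normSq (z k)) ?_ fun t z ht => ?_).symm
  · exact hG.comp (measurable_pi_lambda _ fun k =>
      Complex.continuous_normSq.measurable.comp (measurable_pi_apply k))
  · have h : (fun k => Complex.normSq (((t : ℂ) • z) k)) =
        (t * t) • fun k => Complex.normSq (z k) := by
      funext k
      simp [Complex.normSq_ofReal]
    simp only [h]
    exact hscale _ _ (mul_pos ht ht)

lemma measurableSet_pos (n : ℕ) : MeasurableSet {e : Fin n → ℝ | ∀ k, 0 < e k} := by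
  have h : {e : Fin n → ℝ | ∀ k, 0 < e k} = Set.univ.pi fun _ => Set.Ioi 0 := by
    ext e
    simp
  rw [h]
  exact MeasurableSet.univ_pi fun _ => measurableSet_Ioi

lemma measurableSet_corner (n : ℕ) :
    MeasurableSet {e : Fin n → ℝ | (∀ k, 0 < e k) ∧ ∑ k, e k < 1} :=
  (measurableSet_pos n).inter
    (measurableSet_lt (f := fun e : Fin n → ℝ => ∑ k, e k) (by fun_prop) measurable_const)

lemma smul_pos_iff_forall {n : ℕ} {t : ℝ} (ht : 0 < t) (e : Fin n → ℝ) :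
    t • e ∈ {e : Fin n → ℝ | ∀ k, 0 < e k} ↔ e ∈ {e : Fin n → ℝ | ∀ k, 0 < e k} := by
  simp [ht]

/-- Failure of positivity is scale invariant, and its indicator vanishes on the open corner. -/
lemma ae_lastRowWeight_pos :
    ∀ᵐ U ∂haarUnitary (m + 1), ∀ k, 0 < lastRowWeight (m := m) U k := by
  have hms := (measurableSet_pos (m + 1)).compl
  have h := lintegral_lastRowWeight (m := m)
    (G := Set.indicator {e : Fin (m + 1) → ℝ | ∀ k, 0 < e k}ᶜ 1)
    (measurable_one.indicator hms) fun t e ht => by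
      simp only [Set.indicator_apply, Set.mem_compl_iff, smul_pos_iff_forall ht, Pi.one_apply]
  have h0 : ∫⁻ e in {e : Fin (m + 1) → ℝ | (∀ k, 0 < e k) ∧ ∑ k, e k < 1},
      Set.indicator {e : Fin (m + 1) → ℝ | ∀ k, 0 < e k}ᶜ 1 e = 0 := by
    refine (setLIntegral_congr_fun (measurableSet_corner (m + 1)) fun e he => ?_).trans
      lintegral_zero
    exact Set.indicator_of_notMem (Set.notMem_compl_iff.mpr
      (show e ∈ {e : Fin (m + 1) → ℝ | ∀ k, 0 < e k} from he.1)) _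
  rw [h0, mul_zero, mul_eq_zero, or_iff_right (volume_complexBall_ne_zero _)] at h
  have h' := (lintegral_eq_zero_iff
    ((measurable_one.indicator hms).comp measurable_lastRowWeight)).mp h
  filter_upwards [h'] with U hU
  by_contra hc
  simp [Set.indicator_of_mem (s := {e : Fin (m + 1) → ℝ | ∀ k, 0 < e k}ᶜ) hc] at hU

/-- The law of the eigenvalues of the minor: its density is proportional to the Vandermonde
determinant on the product of the gaps. -/
theorem exists_map_minorEigenvalue_eq (hl : StrictAnti l) {Ω : Type*} [MeasurableSpace Ω]
    {μ : Measure Ω} {A : Ω → Matrix (Fin (m + 1)) (Fin (m + 1)) ℂ}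
    (hA : ∀ ω, (A ω).IsHermitian) (hlaw : HasLaw A (uniformHermitian l) μ) :
    AEMeasurable (fun ω => minorEigenvalue (hA ω)) μ ∧
      (∀ᵐ ω ∂μ, minorEigenvalue (hA ω) ∈ gapBox l) ∧
      ∃ c : ENNReal, c ≠ ⊤ ∧ μ.map (fun ω => minorEigenvalue (hA ω)) =
        c • (volume.restrict (gapBox l)).withDensity
          fun x => ENNReal.ofReal |(Matrix.vandermonde x).det| := by
  obtain ⟨X, hXm, hX⟩ := exists_measurable_leftInverse_weightMap hl
  obtain ⟨c, hc, hcX⟩ := exists_setLIntegral_corner_eq hl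
  have hWm : AEMeasurable (fun ω => minorWeight l (A ω)) μ :=
    (measurable_minorWeight l).comp_aemeasurable hlaw.aemeasurable
  have hconj : ∀ U : Matrix.unitaryGroup (Fin (m + 1)) ℂ,
      minorWeight l ((U : Matrix (Fin (m + 1)) (Fin (m + 1)) ℂ) *
        Matrix.diagonal (fun i => (l i : ℂ)) *
          star (U : Matrix (Fin (m + 1)) (Fin (m + 1)) ℂ)) = lastRowWeight U :=
    fun U => funext fun k => minorWeight_unitary_conj hl U k
  have hWmap : μ.map (fun ω => minorWeight l (A ω)) =
      (haarUnitary (m + 1)).map lastRowWeight := by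
    have h1 : μ.map (fun ω => minorWeight l (A ω)) = (μ.map A).map (minorWeight l) :=
      (AEMeasurable.map_map_of_aemeasurable (measurable_minorWeight l).aemeasurable
        hlaw.aemeasurable).symm
    rw [h1, hlaw.map_eq, uniformHermitian,
      Measure.map_map (measurable_minorWeight l) (measurable_unitary_conj l)]
    exact congrArg (fun f => Measure.map f (haarUnitary (m + 1))) (funext hconj)
  have hpos : ∀ᵐ ω ∂μ, ∀ k, 0 < minorWeight l (A ω) k := by
    have h : ∀ᵐ e ∂μ.map (fun ω => minorWeight l (A ω)), ∀ k, 0 < e k := by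
      rw [hWmap, ae_map_iff measurable_lastRowWeight.aemeasurable (measurableSet_pos _)]
      exact ae_lastRowWeight_pos
    exact (ae_map_iff hWm (measurableSet_pos _)).mp h
  have hev : ∀ᵐ ω ∂μ, minorEigenvalue (hA ω) ∈ gapBox l ∧
      X (minorWeight l (A ω)) = minorEigenvalue (hA ω) := by
    filter_upwards [hpos] with ω hω
    obtain ⟨y, hy, hyw, hye⟩ := exists_weightMap_eq_minorWeight hl (hA ω) hω
    exact ⟨hye ▸ hy.2, by rw [← hyw, hX y hy, hye]⟩
  have hevX : (fun ω => minorEigenvalue (hA ω)) =ᵐ[μ] fun ω => X (minorWeight l (A ω)) :=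
    hev.mono fun ω hω => hω.2.symm
  have hevm : AEMeasurable (fun ω => minorEigenvalue (hA ω)) μ :=
    (hXm.comp_aemeasurable hWm).congr hevX.symm
  refine ⟨hevm, hev.mono fun ω hω => hω.1,
    (volume (complexBall (m + 1)))⁻¹ * (ENNReal.ofReal Real.pi ^ (m + 1) * c), ?_, ?_⟩
  · exact ENNReal.mul_ne_top (ENNReal.inv_ne_top.mpr (volume_complexBall_ne_zero _))
      (ENNReal.mul_ne_top (ENNReal.pow_ne_top ENNReal.ofReal_ne_top) hc)
  ext s hs
  set P : Set (Fin (m + 1) → ℝ) := {e | ∀ k, 0 < e k} with hP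
  have hPm : MeasurableSet P := measurableSet_pos _
  set F : (Fin m → ℝ) → ENNReal := s.indicator 1 with hF
  have hFm : Measurable F := measurable_one.indicator hs
  -- `X` is controlled only on positive weights, so `F (X e)` is cut off elsewhere to make it scale
  -- invariant.
  set G : (Fin (m + 1) → ℝ) → ENNReal := P.indicator fun e => F (X e) with hG
  have hGm : Measurable G := (hFm.comp hXm).indicator hPm
  have hGscale : ∀ (t : ℝ) (e : Fin (m + 1) → ℝ), 0 < t → G (t • e) = G e := by
    intro t e ht
    simp only [hG, Set.indicator_apply, hP, smul_pos_iff_forall ht]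
    split_ifs with he
    · obtain ⟨y, hy, rfl⟩ := exists_weightMap_eq hl he
      have hty : Fin.cons (t * y 0) (Fin.tail y) ∈ gapCone l :=
        ⟨by simpa using mul_pos ht hy.1, by simpa using hy.2⟩
      have h : t • weightMap l y = weightMap l (Fin.cons (t * y 0) (Fin.tail y)) := by
        funext k
        simp only [Pi.smul_apply, smul_eq_mul, weightMap, Fin.cons_zero, Fin.tail_cons]
        ring
      rw [h, hX _ hty, hX y hy, Fin.tail_cons]
    · rfl
  have hleft : μ.map (fun ω => minorEigenvalue (hA ω)) s =
      ∫⁻ U, G (lastRowWeight U) ∂haarUnitary (m + 1) := by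
    rw [← lintegral_map hGm measurable_lastRowWeight, ← hWmap, lintegral_map' hGm.aemeasurable hWm,
      ← lintegral_indicator_one hs, lintegral_map' hFm.aemeasurable hevm]
    refine lintegral_congr_ae ?_
    filter_upwards [hpos, hev] with ω h1 h2
    rw [hG, Set.indicator_of_mem (s := P) h1, h2.2]
  have hright : ∫⁻ e in {e : Fin (m + 1) → ℝ | (∀ k, 0 < e k) ∧ ∑ k, e k < 1}, G e =
      c * ((volume.restrict (gapBox l)).withDensity
        fun x => ENNReal.ofReal |(Matrix.vandermonde x).det|) s := by
    have h1 : ∀ e ∈ {e : Fin (m + 1) → ℝ | (∀ k, 0 < e k) ∧ ∑ k, e k < 1}, G e = F (X e) :=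
      fun e he => Set.indicator_of_mem (s := P) he.1 _
    rw [setLIntegral_congr_fun (measurableSet_corner (m + 1)) h1,
      hcX X hX F hFm, withDensity_apply _ hs, ← lintegral_indicator hs]
    congr 1
    refine lintegral_congr fun x => ?_
    by_cases hx : x ∈ s <;> simp [hF, hx]
  have hmain := lintegral_lastRowWeight hGm hGscale
  rw [hright, ← hleft] at hmain
  rw [Measure.smul_apply, smul_eq_mul, mul_assoc, mul_assoc, ← hmain, ← mul_assoc,
    ENNReal.inv_mul_cancel (volume_complexBall_ne_zero _) (volume_complexBall_ne_top _), one_mul]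

end Law

/-! ### The determinantal form of the density. -/

section Determinants

variable {m : ℕ} {l : Fin (m + 1) → ℝ}

/-- The joint density of the eigenvalues of the minor on the product of the gaps. -/
noncomputable def gapDensity (l : Fin (m + 1) → ℝ) (x : Fin m → ℝ) : ℝ :=
  (Matrix.of fun j i : Fin m => (derivative (stepPoly l j.castSucc)).eval (x i)).det

lemma integrableOn_openGap (i : Fin m) {f : ℝ → ℝ} (hf : Continuous f) :
    Integrable f (volume.restrict (Set.Ioo (l i.succ) (l i.castSucc))) :=
  (hf.integrableOn_Icc).mono_set Set.Ioo_subset_Icc_self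

/-- Expand the determinant over permutations; each term is a product of one-variable functions, and
Fubini applies. -/
lemma integral_prod_mul_gapDensity (l : Fin (m + 1) → ℝ) {f : Fin m → ℝ → ℝ}
    (hf : ∀ i, Continuous (f i)) :
    ∫ x in gapBox l, (∏ i, f i (x i)) * gapDensity l x =
      (Matrix.of fun j i : Fin m => ∫ t in Set.Ioo (l i.succ) (l i.castSucc),
        f i t * (derivative (stepPoly l j.castSucc)).eval t).det := by
  have hexp : ∀ x : Fin m → ℝ, (∏ i, f i (x i)) * gapDensity l x =
      ∑ σ : Equiv.Perm (Fin m), ((Equiv.Perm.sign σ : ℤ) : ℝ) *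
        ∏ i, (f i (x i) * (derivative (stepPoly l (σ i).castSucc)).eval (x i)) := by
    intro x
    rw [gapDensity, Matrix.det_apply', Finset.mul_sum]
    refine Finset.sum_congr rfl fun σ _ => ?_
    simp only [Matrix.of_apply, Finset.prod_mul_distrib]
    ring
  have hbox : (volume : Measure (Fin m → ℝ)).restrict (gapBox l) =
      Measure.pi fun i => volume.restrict (Set.Ioo (l i.succ) (l i.castSucc)) := by
    rw [gapBox, volume_pi, Measure.restrict_pi_pi]
  have hcont : ∀ i j : Fin m,
      Continuous fun t => f i t * (derivative (stepPoly l j.castSucc)).eval t :=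
    fun i j => (hf i).mul (derivative (stepPoly l j.castSucc)).continuous
  simp only [hexp]
  rw [hbox, integral_finsetSum, Matrix.det_apply']
  · refine Finset.sum_congr rfl fun σ _ => ?_
    rw [integral_const_mul, integral_fintype_prod_eq_prod
      (fun i t => f i t * (derivative (stepPoly l (σ i).castSucc)).eval t)]
    rfl
  · intro σ _
    exact (Integrable.fintype_prod_dep
      (f := fun i t => f i t * (derivative (stepPoly l (σ i).castSucc)).eval t)
      fun i => integrableOn_openGap i (hcont i (σ i))).const_mul _

lemma integral_gapDensity (hl : StrictAnti l) : ∫ x in gapBox l, gapDensity l x = 1 := by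
  have h := integral_prod_mul_gapDensity l (f := fun _ _ => 1) fun _ => continuous_const
  simp only [Finset.prod_const_one, one_mul, integral_openGap_derivative_stepPoly hl] at h
  rw [h, ← Matrix.det_one (n := Fin m) (R := ℝ), ← Matrix.det_transpose]
  rfl

/-- The derivatives have degree below `m`, so evaluating them factors through the Vandermonde
matrix. -/
lemma gapDensity_eq_mul_vandermonde (hl : StrictAnti l) (x : Fin m → ℝ) :
    gapDensity l x =
      (Matrix.of fun d j : Fin m => (derivative (stepPoly l j.castSucc)).coeff d).det *
        (Matrix.vandermonde x).det := by
  rw [mul_comm, ← Matrix.det_mul, gapDensity, ← Matrix.det_transpose]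
  congr 1
  ext i j
  have hdeg : (derivative (stepPoly l j.castSucc)).natDegree < m := by
    have h1 := natDegree_derivative_le (stepPoly l j.castSucc)
    have h2 := stepPoly_natDegree_le hl j.castSucc
    have := j.pos
    omega
  rw [Matrix.mul_apply, Matrix.transpose_apply, Matrix.of_apply, eval_eq_sum_range' hdeg,
    Finset.sum_range]
  exact Finset.sum_congr rfl fun _ _ => mul_comm _ _

lemma exists_gapDensity_eq_mul_abs (hl : StrictAnti l) :
    ∃ q : ℝ, ∀ x ∈ gapBox l, gapDensity l x = q * |(Matrix.vandermonde x).det| := by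
  refine ⟨(Matrix.of fun d j : Fin m => (derivative (stepPoly l j.castSucc)).coeff d).det *
    ∏ i : Fin m, ∏ _j ∈ Finset.Ioi i, (-1), fun x hx => ?_⟩
  have hanti := strictAnti_of_mem_gaps hl (mem_gapBox.mp hx)
  rw [gapDensity_eq_mul_vandermonde hl, mul_assoc]
  congr 1
  rw [Matrix.det_vandermonde]
  simp only [Finset.abs_prod, ← Finset.prod_mul_distrib]
  refine Finset.prod_congr rfl fun i _ => Finset.prod_congr rfl fun j hj => ?_
  rw [abs_of_neg (sub_neg.mpr (hanti (Finset.mem_Ioi.mp hj)))]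
  ring

lemma integral_withDensity_vandermonde (s : Set (Fin m → ℝ)) (f : (Fin m → ℝ) → ℝ) :
    ∫ x, f x ∂((volume.restrict s).withDensity
        fun x => ENNReal.ofReal |(Matrix.vandermonde x).det|) =
      ∫ x in s, |(Matrix.vandermonde x).det| * f x := by
  rw [integral_withDensity_eq_integral_toReal_smul measurable_abs_det_vandermonde
    (Filter.Eventually.of_forall fun _ => ENNReal.ofReal_lt_top)]
  simp [ENNReal.toReal_ofReal, abs_nonneg]

/-- Expectations of functions of the eigenvalues of the minor. -/
theorem integral_comp_minorEigenvalue (hl : StrictAnti l) {Ω : Type*} [MeasurableSpace Ω]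
    {μ : Measure Ω} [IsProbabilityMeasure μ] {A : Ω → Matrix (Fin (m + 1)) (Fin (m + 1)) ℂ}
    (hA : ∀ ω, (A ω).IsHermitian) (hlaw : HasLaw A (uniformHermitian l) μ)
    {f : (Fin m → ℝ) → ℝ} (hf : Continuous f) :
    ∫ ω, f (minorEigenvalue (hA ω)) ∂μ = ∫ x in gapBox l, f x * gapDensity l x := by
  obtain ⟨hm, -, c, -, hmap⟩ := exists_map_minorEigenvalue_eq hl hA hlaw
  obtain ⟨q, hq⟩ := exists_gapDensity_eq_mul_abs hl
  have hc : ∀ f : (Fin m → ℝ) → ℝ, Continuous f → ∫ ω, f (minorEigenvalue (hA ω)) ∂μ =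
      c.toReal * ∫ x in gapBox l, |(Matrix.vandermonde x).det| * f x := by
    intro f hf
    rw [← integral_map hm hf.aestronglyMeasurable, hmap, integral_smul_measure,
      integral_withDensity_vandermonde, smul_eq_mul]
  have hd : ∀ f : (Fin m → ℝ) → ℝ, ∫ x in gapBox l, f x * gapDensity l x =
      q * ∫ x in gapBox l, |(Matrix.vandermonde x).det| * f x := by
    intro f
    rw [← integral_const_mul]
    refine setIntegral_congr_fun (measurableSet_gapBox l) fun x hx => ?_
    simp only [hq x hx]
    ring
  -- Testing on the constant 1 identifies the two unknown constants: both densities have total mass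
  -- 1.
  have h1 := hc (fun _ => 1) continuous_const
  have h2 := hd fun _ => 1
  simp only [one_mul, integral_gapDensity hl, integral_const, probReal_univ, smul_eq_mul,
    mul_one] at h1 h2
  have hV : (∫ x in gapBox l, |(Matrix.vandermonde x).det|) ≠ 0 := fun h => by
    rw [h, mul_zero] at h1
    exact one_ne_zero h1
  rw [hc f hf, hd, mul_right_cancel₀ hV (h1.symm.trans h2)]

lemma det_updateCol_one {n R : Type*} [Fintype n] [DecidableEq n] [CommRing R] (i : n)
    (u : n → R) : ((1 : Matrix n n R).updateCol i u).det = u i := by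
  rw [← Matrix.cramer_apply, Matrix.cramer_one]
  rfl

/-- The matrix is a perturbation `1 + P * Q` through `Fin 2`, and `det (1 + P * Q) = det (1 + Q *
P)` reduces it to size 2. -/
lemma det_updateCol_updateCol_one {n R : Type*} [Fintype n] [DecidableEq n] [CommRing R] {i j : n}
    (hij : i ≠ j) (u v : n → R) :
    (((1 : Matrix n n R).updateCol i u).updateCol j v).det = u i * v j - u j * v i := by
  set P : Matrix n (Fin 2) R := Matrix.of fun k a =>
    ![u k - (1 : Matrix n n R) k i, v k - (1 : Matrix n n R) k j] a
  set Q : Matrix (Fin 2) n R := Matrix.of fun a k =>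
    ![(1 : Matrix n n R) i k, (1 : Matrix n n R) j k] a
  have h : ((1 : Matrix n n R).updateCol i u).updateCol j v = 1 + P * Q := by
    ext a b
    simp only [Matrix.updateCol_apply, Matrix.add_apply, Matrix.mul_apply, Fin.sum_univ_two, P, Q,
      Matrix.of_apply, Matrix.cons_val_zero, Matrix.cons_val_one, Matrix.one_apply]
    by_cases hbj : b = j
    · subst hbj
      simp [hij]
    · by_cases hbi : b = i
      · subst hbi
        simp [hij, hij.symm]
      · simp [hbj, hbi, Ne.symm hbj, Ne.symm hbi]
  have hQP : Q * P = !![u i - 1, v i; u j, v j - 1] := by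
    ext a b
    fin_cases a <;> fin_cases b <;>
      simp [Matrix.mul_apply, P, Q, Matrix.one_apply, hij, hij.symm]
  rw [h, Matrix.det_one_add_mul_comm, hQP, Matrix.det_fin_two]
  simp
  ring

end Determinants

/-! ### Moments in one and two variables. -/

section Moments

variable {m : ℕ} {l : Fin (m + 1) → ℝ}

lemma setIntegral_one_mul_derivative (hl : StrictAnti l) (i j : Fin m) :
    ∫ t in Set.Ioo (l i.succ) (l i.castSucc),
        1 * (derivative (stepPoly l j.castSucc)).eval t = (1 : Matrix (Fin m) (Fin m) ℝ) j i := by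
  simp only [one_mul]
  rw [integral_openGap_derivative_stepPoly hl, Matrix.one_apply, Matrix.one_apply]
  simp only [eq_comm]

/-- With the constant 1 in the other variables, duality makes every column but the `i`-th a column
of the identity. -/
lemma integral_mul_gapDensity_single (hl : StrictAnti l) (i : Fin m) {φ : ℝ → ℝ}
    (hφ : Continuous φ) :
    ∫ x in gapBox l, φ (x i) * gapDensity l x =
      ∫ t in Set.Ioo (l i.succ) (l i.castSucc),
        φ t * (derivative (stepPoly l i.castSucc)).eval t := by
  have h := integral_prod_mul_gapDensity l (f := Function.update (fun _ _ => 1) i φ) fun k => by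
    by_cases hk : k = i
    · subst hk
      simpa using hφ
    · simpa [Function.update_of_ne hk] using continuous_const
  have hprod : ∀ x : Fin m → ℝ,
      ∏ k, (Function.update (fun _ _ => 1) i φ : Fin m → ℝ → ℝ) k (x k) = φ (x i) := fun x => by
    rw [Finset.prod_eq_single i (fun k _ hk => by simp [Function.update_of_ne hk]) (by simp)]
    simp
  have hmat : (Matrix.of fun j k : Fin m => ∫ t in Set.Ioo (l k.succ) (l k.castSucc),
      (Function.update (fun _ _ => 1) i φ : Fin m → ℝ → ℝ) k t *
        (derivative (stepPoly l j.castSucc)).eval t) =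
      (1 : Matrix (Fin m) (Fin m) ℝ).updateCol i fun j =>
        ∫ t in Set.Ioo (l i.succ) (l i.castSucc),
          φ t * (derivative (stepPoly l j.castSucc)).eval t := by
    ext j k
    rw [Matrix.of_apply, Matrix.updateCol_apply]
    split_ifs with hk
    · subst hk
      simp
    · simp only [Function.update_of_ne hk]
      exact setIntegral_one_mul_derivative hl k j
  simp only [hprod] at h
  rw [h, hmat, det_updateCol_one]

lemma integral_mul_gapDensity_pair (hl : StrictAnti l) {i j : Fin m} (hij : i ≠ j) {φ ψ : ℝ → ℝ}
    (hφ : Continuous φ) (hψ : Continuous ψ) :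
    ∫ x in gapBox l, (φ (x i) * ψ (x j)) * gapDensity l x =
      (∫ t in Set.Ioo (l i.succ) (l i.castSucc),
          φ t * (derivative (stepPoly l i.castSucc)).eval t) *
        (∫ t in Set.Ioo (l j.succ) (l j.castSucc),
          ψ t * (derivative (stepPoly l j.castSucc)).eval t) -
      (∫ t in Set.Ioo (l i.succ) (l i.castSucc),
          φ t * (derivative (stepPoly l j.castSucc)).eval t) *
        ∫ t in Set.Ioo (l j.succ) (l j.castSucc),
          ψ t * (derivative (stepPoly l i.castSucc)).eval t := by
  set f : Fin m → ℝ → ℝ := Function.update (Function.update (fun _ _ => 1) i φ) j ψ with hf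
  have hfj : f j = ψ := by simp [hf]
  have hfi : f i = φ := by simp [hf, Function.update_of_ne hij]
  have hfk : ∀ k, k ≠ i → k ≠ j → f k = fun _ => 1 := fun k hki hkj => by
    simp [hf, Function.update_of_ne hki, Function.update_of_ne hkj]
  have h := integral_prod_mul_gapDensity l (f := f) fun k => by
    by_cases hkj : k = j
    · rw [hkj, hfj]
      exact hψ
    · by_cases hki : k = i
      · rw [hki, hfi]
        exact hφ
      · rw [hfk k hki hkj]
        exact continuous_const
  have hprod : ∀ x : Fin m → ℝ, ∏ k, f k (x k) = φ (x i) * ψ (x j) := fun x => by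
    rw [Fintype.prod_eq_mul i j hij fun k hk => by rw [hfk k hk.1 hk.2], hfi, hfj]
  have hmat : (Matrix.of fun a k : Fin m => ∫ t in Set.Ioo (l k.succ) (l k.castSucc),
      f k t * (derivative (stepPoly l a.castSucc)).eval t) =
      ((1 : Matrix (Fin m) (Fin m) ℝ).updateCol i fun a =>
        ∫ t in Set.Ioo (l i.succ) (l i.castSucc),
          φ t * (derivative (stepPoly l a.castSucc)).eval t).updateCol j fun a =>
        ∫ t in Set.Ioo (l j.succ) (l j.castSucc),
          ψ t * (derivative (stepPoly l a.castSucc)).eval t := by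
    ext a k
    rw [Matrix.of_apply, Matrix.updateCol_apply, Matrix.updateCol_apply]
    split_ifs with hkj hki
    · rw [hkj, hfj]
    · rw [hki, hfi]
    · rw [hfk k hki hkj]
      exact setIntegral_one_mul_derivative hl k a
  simp only [hprod] at h
  rw [h, hmat, det_updateCol_updateCol_one hij]

end Moments

/-! ### The main theorem. -/

theorem proposition6 (m : ℕ) (l : Fin (m + 1) → ℝ) (hl : StrictAnti l)
    {Ω : Type*} [MeasurableSpace Ω] (μ : Measure Ω) [IsProbabilityMeasure μ]
    (A : Ω → Matrix (Fin (m + 1)) (Fin (m + 1)) ℂ) (hA : ∀ ω, (A ω).IsHermitian)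
    (hlaw : HasLaw A (uniformHermitian l) μ) :
    -- `stepPoly l j` is the unique polynomial of degree `≤ m` with value `1_{i ≤ j}` at `l i`
    (∀ (j : Fin (m + 1)) (q : ℝ[X]),
      (q.natDegree ≤ m ∧ ∀ i, q.eval (l i) = if i ≤ j then 1 else 0) ↔ q = stepPoly l j) ∧
    (∀ j : Fin m, (stepPoly l j.castSucc).natDegree = m) ∧
    -- the gaps are square integrable, so that the moments below are meaningful
    (∀ i : Fin m, MemLp (fun ω => l i.castSucc - minorEigenvalue (hA ω) i) 2 μ) ∧
    (∀ i : Fin m,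
      ∫ ω, (l i.castSucc - minorEigenvalue (hA ω) i) ∂μ =
        ∫ x in gapInterval l i, (stepPoly l i.castSucc).eval x) ∧
    (∀ i j : Fin m, i < j →
      cov[fun ω => l i.castSucc - minorEigenvalue (hA ω) i,
          fun ω => l j.castSucc - minorEigenvalue (hA ω) j; μ] =
        (∫ x in gapInterval l i, (1 - (stepPoly l j.castSucc).eval x)) *
          ∫ x in gapInterval l j, (stepPoly l i.castSucc).eval x) := by
  have hmem : ∀ i : Fin m, MemLp (fun ω => l i.castSucc - minorEigenvalue (hA ω) i) 2 μ := by
    intro i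
    obtain ⟨hm, hbox, -⟩ := exists_map_minorEigenvalue_eq hl hA hlaw
    refine MemLp.of_bound ?_ (l i.castSucc - l i.succ) ?_
    · exact (aemeasurable_const.sub
        ((measurable_pi_apply i).comp_aemeasurable hm)).aestronglyMeasurable
    · filter_upwards [hbox] with ω hω
      have h := mem_gapBox.mp hω i
      rw [Real.norm_eq_abs, abs_of_pos (sub_pos.mpr h.2)]
      linarith [h.1]
  have hmean : ∀ i : Fin m, ∫ ω, (l i.castSucc - minorEigenvalue (hA ω) i) ∂μ =
      ∫ x in gapInterval l i, (stepPoly l i.castSucc).eval x := by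
    intro i
    rw [integral_comp_minorEigenvalue hl hA hlaw
      (f := fun x => l i.castSucc - x i) (by fun_prop),
      integral_mul_gapDensity_single hl i (φ := fun t => l i.castSucc - t) (by fun_prop),
      integral_openGap_of_le hl le_rfl]
  refine ⟨eq_stepPoly_iff hl, stepPoly_natDegree hl, hmem, hmean, fun i j hij => ?_⟩
  rw [covariance_eq_sub (hmem i) (hmem j), hmean, hmean]
  simp only [Pi.mul_apply]
  -- The diagonal product of the `2 × 2` determinant cancels the product of the means. In the
  -- off-diagonal one, the minus sign from `integral_openGap_of_lt` cancels that of the determinant.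
  rw [integral_comp_minorEigenvalue hl hA hlaw
    (f := fun x => (l i.castSucc - x i) * (l j.castSucc - x j)) (by fun_prop),
    integral_mul_gapDensity_pair hl hij.ne (φ := fun t => l i.castSucc - t)
      (ψ := fun t => l j.castSucc - t) (by fun_prop) (by fun_prop),
    integral_openGap_of_le hl le_rfl, integral_openGap_of_le hl le_rfl,
    integral_openGap_of_lt hl hij, integral_openGap_of_le hl hij.le]
  ring
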